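/- Probabilistic programs over a countably infinite set $\mathsf{Var}=\{v_0,v_1,v_2,\dots\}$ of variables are given by the grammar $$P ::= v:=e \;\mid\; P;P \;\mid\; \{P\}\,[p]\,\{P\} \;\mid\; \mathtt{WHILE}\,(b)\,\{P\},$$ where $v\in\mathsf{Var}$, $p\in[0,1]\cap\mathbb Q$, $e$ is an arithmetical expression (built from variables and non-negative rational constants by $+,-,\cdot$) and $b$ is a Boolean expression (built from comparisons $e_1=e_2$, $e_1\le e_2$ by negation and conjunction). A valuation is a function $\eta:\mathsf{Var}\to\mathbb Q_{\ge0}$ that is zero on all but finitely many variables. States are quadruples $\langle P,\eta,a,\theta\rangle$ of a remaining program $P$ (possibly the terminated program $\downarrow$, or a concatenation whose first component has been partially or completely executed), a valuation $\eta$, a probability $a\in[0,1]\cap\mathbb Q$ and a word $\theta\in\{L,R\}^*$. The one-step relation $\vdash$ is the least relation with * $\langle v:=e,\eta,a,\theta\rangle\vdash\langle\downarrow,\eta[v\mapsto\max\{[\![e]\!]_\eta,0\}],a,\theta\rangle$; * $\langle P_1;P_2,\eta,a,\theta\rangle\vdash\langle P_1';P_2,\eta',a',\theta'\rangle$ whenever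 $\langle P_1,\eta,a,\theta\rangle\vdash\langle P_1',\eta',a',\theta'\rangle$, and $\langle\downarrow;P_2,\eta,a,\theta\rangle\vdash\langle P_2,\eta,a,\theta\rangle$; * $\langle\{P_1\}[p]\{P_2\},\eta,a,\theta\rangle\vdash\langle P_1,\eta,a\cdot p,\theta L\rangle$ and $\langle\{P_1\}[p]\{P_2\},\eta,a,\theta\rangle\vdash\langle P_2,\eta,a\cdot(1-p),\theta R\rangle$; * $\langle\mathtt{WHILE}(b)\{P\},\eta,a,\theta\rangle\vdash\langle P;\mathtt{WHILE}(b)\{P\},\eta,a,\theta\rangle$ if $[\![b]\!]_\eta$ is true, and $\langle\mathtt{WHILE}(b)\{P\},\eta,a,\theta\rangle\vdash\langle\downarrow,\eta,a,\theta\rangle$ if $[\![b]\!]_\eta$ is false. For $k\in\mathbb N$, a state $\sigma$ and $w\in\{L,R\}^*$ let $T_k(\sigma,w)$ be the state reached from $\sigma$ after exactly $k$ steps when the probabilistic choices met on the way are resolved by, and use up exactly, the word $w$; put $T_k(\sigma,w)=\bot$ if there is no such state. Let $\alpha(\langle\downarrow,\eta,a,\theta\rangle)=a$ and let $\alpha$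 be $0$ on $\bot$ and on all other states. The expected time until termination of $P$ on input $\eta$ is $$E_{P,\eta}(\downarrow)=\sum_{k=0}^\infty\Bigl(1-\sum_{j=0}^{k}\;\sum_{w\in\{L,R\}^{*},\,|w|\le j}\alpha\bigl(T_j(\langle P,\eta,1,\varepsilon\rangle,w)\bigr)\Bigr)\in[0,\infty],$$ that is, the sum over all $k$ of the probability that $P$ runs for more than $k$ steps on $\eta$. Let $$\mathcal{PAST}=\{(P,\eta)\mid E_{P,\eta}(\downarrow)<\infty\}.$$ A set $A$ of finite objects (with a fixed effective coding by natural numbers) is in $\Sigma_2^0$ if there is a decidable relation $R$ with $x\in A\iff\exists y_1\in\mathbb N\;\forall y_2\in\mathbb N:\ (x,y_1,y_2)\in R$. It is $\Sigma_2^0$-complete if it is in $\Sigma_2^0$ and every set $C\in\Sigma_2^0$ is many-one reducible to it, i.e. there is a total computable $f$ with $x\in C\iff f(x)\in A$ for all $x$. **Theorem.** $\mathcal{PAST}$ is $\Sigma_2^0$-complete. -/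

import Mathlib

open scoped NNRat ENNReal

namespace PGCL

/-! ### Syntax -/

/-- Program variables. -/
abbrev Var : Type := ℕ

/-- Arithmetical expressions over the program variables. -/
inductive AExpr : Type
  | const (q : ℚ≥0)
  | var (v : Var)
  | add (e₁ e₂ : AExpr)
  | sub (e₁ e₂ : AExpr)
  | mul (e₁ e₂ : AExpr)

/-- Boolean expressions over arithmetical expressions. -/
inductive BExpr : Type
  | eq (e₁ e₂ : AExpr)
  | le (e₁ e₂ : AExpr)
  | not (b : BExpr)
  | and (b₁ b₂ : BExpr)

/-- Rational probabilities, the set `[0, 1] ∩ ℚ`. -/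
abbrev Prob : Type := Set.Icc (0 : ℚ) 1

/-- The complementary probability `1 - p`. -/
def Prob.compl (p : Prob) : Prob := ⟨1 - (p : ℚ), Set.Icc.one_sub_mem p.2⟩

/-- Probabilistic programs: `v := e`, `P ; Q`, `{P} [p] {Q}` and `WHILE (b) {P}`. -/
inductive Prog : Type
  | assign (v : Var) (e : AExpr)
  | seq (P Q : Prog)
  | choice (P : Prog) (p : Prob) (Q : Prog)
  | loop (b : BExpr) (P : Prog)

/-! ### Semantics -/

/-- Variable valuations with values in the non-negative rationals. In order that inputs are finite
objects, all but finitely many variables have the value `0`. -/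
abbrev Val : Type := Var →₀ ℚ≥0

/-- The value `⟦e⟧_η` of an arithmetical expression (it may be negative). -/
def AExpr.eval : AExpr → Val → ℚ
  | const q, _ => (q : ℚ)
  | var v, η => (η v : ℚ)
  | add e₁ e₂, η => e₁.eval η + e₂.eval η
  | sub e₁ e₂, η => e₁.eval η - e₂.eval η
  | mul e₁ e₂, η => e₁.eval η * e₂.eval η

/-- The value `⟦b⟧_η` of a Boolean expression. -/
def BExpr.eval : BExpr → Val → Bool
  | eq e₁ e₂, η => decide (e₁.eval η = e₂.eval η)
  | le e₁ e₂, η => decide (e₁.eval η ≤ e₂.eval η)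
  | not b, η => !b.eval η
  | and b₁ b₂, η => b₁.eval η && b₂.eval η

/-- What is left of a program during its execution: `term` is the terminal symbol `↓`, and the
first component of a concatenation may be partially executed (in particular, it may be `↓`). -/
inductive Cmd : Type
  | term
  | assign (v : Var) (e : AExpr)
  | seq (C : Cmd) (P : Prog)
  | choice (P : Prog) (p : Prob) (Q : Prog)
  | loop (b : BExpr) (P : Prog)

/-- A program, seen as a command of which nothing has been executed. -/
def Prog.toCmd : Prog → Cmd
  | assign v e => .assign v e
  | seq P Q => .seq P.toCmd Q
  | choice P p Q => .choice P p Q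
  | loop b P => .loop b P

/-- The outcome of a probabilistic choice: left or right. -/
inductive Dir : Type
  | L
  | R
  deriving DecidableEq

instance : Fintype Dir := ⟨{.L, .R}, fun d => by cases d <;> simp⟩

/-- Program states `⟨C, η, a, θ⟩`: the command that remains to be executed, the valuation, the
probability of the choices made so far, and the sequence of these choices. -/
@[ext] structure State : Type where
  cmd : Cmd
  val : Val
  prob : Prob
  hist : List Dir

/-- The valuation `η[v ↦ max {q, 0}]`. -/
noncomputable def assignVal (η : Val) (v : Var) (q : ℚ) : Val := η.update v q.toNNRat

/-- The one-step relation `⊢` between states. -/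
inductive Step : State → State → Prop
  | assign (v e η a θ) :
      Step ⟨.assign v e, η, a, θ⟩ ⟨.term, assignVal η v (e.eval η), a, θ⟩
  | concat1 (C C' P η η' a a' θ θ') : Step ⟨C, η, a, θ⟩ ⟨C', η', a', θ'⟩ →
      Step ⟨.seq C P, η, a, θ⟩ ⟨.seq C' P, η', a', θ'⟩
  | concat2 (P : Prog) (η a θ) : Step ⟨.seq .term P, η, a, θ⟩ ⟨P.toCmd, η, a, θ⟩
  | prob1 (P : Prog) (p Q η a θ) :
      Step ⟨.choice P p Q, η, a, θ⟩ ⟨P.toCmd, η, a * p, θ ++ [.L]⟩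
  | prob2 (P p) (Q : Prog) (η a θ) :
      Step ⟨.choice P p Q, η, a, θ⟩ ⟨Q.toCmd, η, a * p.compl, θ ++ [.R]⟩
  | while1 (b) (P : Prog) (η a θ) : b.eval η = true →
      Step ⟨.loop b P, η, a, θ⟩ ⟨.seq P.toCmd (.loop b P), η, a, θ⟩
  | while2 (b P η a θ) : b.eval η = false →
      Step ⟨.loop b P, η, a, θ⟩ ⟨.term, η, a, θ⟩

/-- The successor of the state `⟨C, η, a, θ⟩` if a probabilistic choice, should one be due, is
resolved by the first letter of the given word, together with the rest of that word. -/
noncomputable def next : Cmd → Val → Prob → List Dir → List Dir → Option (State × List Dir)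
  | .term, _, _, _, _ => none
  | .assign v e, η, a, θ, w => some (⟨.term, assignVal η v (e.eval η), a, θ⟩, w)
  | .seq .term P, η, a, θ, w => some (⟨P.toCmd, η, a, θ⟩, w)
  | .seq C P, η, a, θ, w =>
      (next C η a θ w).map fun r => (⟨.seq r.1.cmd P, r.1.val, r.1.prob, r.1.hist⟩, r.2)
  | .choice _ _ _, _, _, _, [] => none
  | .choice P p _, η, a, θ, .L :: w => some (⟨P.toCmd, η, a * p, θ ++ [.L]⟩, w)
  | .choice _ p Q, η, a, θ, .R :: w => some (⟨Q.toCmd, η, a * p.compl, θ ++ [.R]⟩, w)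
  | .loop b P, η, a, θ, w =>
      if b.eval η then some (⟨.seq P.toCmd (.loop b P), η, a, θ⟩, w)
      else some (⟨.term, η, a, θ⟩, w)

theorem next_seq (C : Cmd) (hC : C ≠ .term) (P : Prog) (η : Val) (a : Prob) (θ w : List Dir) :
    next (.seq C P) η a θ w = (next C η a θ w).map fun r =>
      (⟨.seq r.1.cmd P, r.1.val, r.1.prob, r.1.hist⟩, r.2) := by
  cases C <;> simp_all [next]

/-- `next` is the successor function of the relation `Step`. -/
theorem next_eq_some_iff (C : Cmd) (η : Val) (a : Prob) (θ w w' : List Dir) (τ : State) :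
    next C η a θ w = some (τ, w') ↔
      Step ⟨C, η, a, θ⟩ τ ∧ ∃ u : List Dir, τ.hist = θ ++ u ∧ w = u ++ w' := by
  constructor
  · intro h
    induction C generalizing τ with
    | term => simp [next] at h
    | assign v e =>
      simp only [next, Option.some.injEq, Prod.mk.injEq] at h
      obtain ⟨rfl, rfl⟩ := h
      exact ⟨.assign .., [], by simp⟩
    | seq C P ih =>
      by_cases hC : C = .term
      · subst hC
        simp only [next, Option.some.injEq, Prod.mk.injEq] at h
        obtain ⟨rfl, rfl⟩ := h
        exact ⟨.concat2 .., [], by simp⟩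
      · rw [next_seq C hC] at h
        simp only [Option.map_eq_some_iff, Prod.exists, Prod.mk.injEq] at h
        obtain ⟨σ, w₁, h, rfl, rfl⟩ := h
        obtain ⟨hs, u, hu⟩ := ih σ h
        exact ⟨.concat1 _ _ _ _ _ _ _ _ _ hs, u, hu⟩
    | choice P p Q =>
      rcases w with _ | ⟨_ | _, w⟩
      · simp [next] at h
      · simp only [next, Option.some.injEq, Prod.mk.injEq] at h
        obtain ⟨rfl, rfl⟩ := h
        exact ⟨.prob1 .., [.L], by simp⟩
      · simp only [next, Option.some.injEq, Prod.mk.injEq] at h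
        obtain ⟨rfl, rfl⟩ := h
        exact ⟨.prob2 .., [.R], by simp⟩
    | loop b P =>
      by_cases hb : b.eval η = true
      · simp only [next, hb, if_true] at h
        obtain ⟨rfl, rfl⟩ := h
        exact ⟨.while1 _ _ _ _ _ hb, [], by simp⟩
      · simp only [next, hb] at h
        obtain ⟨rfl, rfl⟩ := h
        exact ⟨.while2 _ _ _ _ _ (by simpa using hb), [], by simp⟩
  · rintro ⟨hs, u, hu, rfl⟩
    induction C generalizing τ with
    | term => cases hs
    | assign v e => cases hs; simp_all [next]
    | seq C P ih =>
      cases hs with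
      | concat1 _ C' _ _ η' _ a' _ θ' hs =>
        have hC : C ≠ .term := by rintro rfl; cases hs
        rw [next_seq C hC, ih _ hs hu]
        simp
      | concat2 => simp_all [next]
    | choice P p Q =>
      cases hs <;>
      · have := List.append_cancel_left hu
        subst this
        simp [next]
    | loop b P => cases hs <;> simp_all [next]

/-- The state successor function `T_k(σ, w)`: the state that is reached from `σ` in exactly `k`
steps if the probabilistic choices that occur are resolved according to `w` and consume exactly
`w`; `none` stands for `⊥`. -/
noncomputable def T : ℕ → State → List Dir → Option State
  | 0, σ, w => if w = [] then some σ else none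
  | k + 1, σ, w => (next σ.cmd σ.val σ.prob σ.hist w).bind fun r => T k r.1 r.2

/-- The function `α`: the probability stored in a state if that state is terminal, otherwise
`0`. -/
def alpha : Option State → ℚ
  | some ⟨.term, _, a, _⟩ => (a : ℚ)
  | _ => 0

/-- The initial state `σ_{P,η} = ⟨P, η, 1, ε⟩`. -/
def initState (P : Prog) (η : Val) : State := ⟨P.toCmd, η, 1, []⟩

/-- The probability that `P` terminates on `η` after exactly `k` steps: the sum of
`α (T_k(σ_{P,η}, w))` over all words `w` over `{L, R}` of length at most `k`. -/
noncomputable def terminatesAt (P : Prog) (η : Val) (k : ℕ) : ℚ :=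
  ∑ i ∈ Finset.range (k + 1), ∑ w : Fin i → Dir, alpha (T k (initState P η) (List.ofFn w))

/-- The probability that `P` terminates on `η` within `k` steps. -/
noncomputable def terminatesWithin (P : Prog) (η : Val) (k : ℕ) : ℚ :=
  ∑ j ∈ Finset.range (k + 1), terminatesAt P η j

/-- The expected time until termination of `P` on `η`: the sum over all `k` of the probability
that `P` runs for more than `k` steps on `η`. -/
noncomputable def expectedTime (P : Prog) (η : Val) : ℝ≥0∞ :=
  ∑' k : ℕ, ENNReal.ofReal (1 - (terminatesWithin P η k : ℝ))

/-- Positive almost-sure termination. -/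
def PAST (x : Prog × Val) : Prop := expectedTime x.1 x.2 < ∞

/-! ### Gödel numberings of programs and valuations -/

/-- The enumeration `0, 1, 1/2, 2, 1/3, 3/2, 2/3, 3, …` of the non-negative rationals. -/
def ratOfNat : ℕ → ℚ≥0
  | 0 => 0
  | n + 1 =>
      if (n + 1) % 2 = 1 then ratOfNat ((n + 1) / 2) + 1
      else ratOfNat ((n + 1) / 2) / (ratOfNat ((n + 1) / 2) + 1)
  decreasing_by all_goals omega

theorem ratOfNat_odd (n : ℕ) : ratOfNat (2 * n + 1) = ratOfNat n + 1 := by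
  rw [ratOfNat, if_pos (by omega), show (2 * n + 1) / 2 = n by omega]

theorem ratOfNat_even (n : ℕ) : ratOfNat (2 * n) = ratOfNat n / (ratOfNat n + 1) := by
  rcases n with _ | n
  · simp [ratOfNat]
  · rw [show 2 * (n + 1) = 2 * n + 1 + 1 by ring, ratOfNat, if_neg (by omega),
      show (2 * n + 1 + 1) / 2 = n + 1 by omega]

theorem ratOfNat_even_lt (n : ℕ) : ratOfNat (2 * n) < 1 := by
  rw [ratOfNat_even, div_lt_one (by positivity)]
  exact lt_add_one _

theorem ratOfNat_eq_zero (n : ℕ) (h : ratOfNat n = 0) : n = 0 := by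
  induction n using Nat.strong_induction_on with
  | _ n ih =>
    obtain ⟨m, hm | hm⟩ := Nat.even_or_odd' n
    · subst hm
      rcases Nat.eq_zero_or_pos m with rfl | hm
      · rfl
      · rw [ratOfNat_even, div_eq_zero_iff] at h
        rw [ih m (by omega) (h.resolve_right (by positivity))]
    · subst hm
      rw [ratOfNat_odd] at h
      exact absurd h (by positivity)

theorem ratOfNat_bijective : Function.Bijective ratOfNat := by
  constructor
  · intro m
    induction m using Nat.strong_induction_on with
    | _ m ih =>
      intro n h
      obtain ⟨m', hm⟩ := Nat.even_or_odd' m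
      obtain ⟨n', hn⟩ := Nat.even_or_odd' n
      rcases hm with rfl | rfl <;> rcases hn with rfl | rfl
      · rcases Nat.eq_zero_or_pos m' with rfl | hm
        · exact (ratOfNat_eq_zero _ (h.symm.trans (by simp [ratOfNat]))).symm
        · rw [ratOfNat_even, ratOfNat_even, div_eq_div_iff (by positivity) (by positivity)] at h
          rw [ih m' (by omega) (a₂ := n') (by rw [mul_add, mul_add, mul_comm (ratOfNat n')] at h; simpa using h)]
      · have := ratOfNat_even_lt m'
        rw [h, ratOfNat_odd] at this
        exact absurd this (by simp)
      · have := ratOfNat_even_lt n'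
        rw [← h, ratOfNat_odd] at this
        exact absurd this (by simp)
      · rw [ratOfNat_odd, ratOfNat_odd] at h
        rw [ih m' (by omega) (add_right_cancel h)]
  · suffices H : ∀ (s a b : ℕ), a + b = s → 0 < b → ∃ n, ratOfNat n = (a : ℚ≥0) / b by
      intro q
      obtain ⟨n, hn⟩ := H _ q.num q.den rfl q.den_pos
      exact ⟨n, hn.trans q.num_div_den⟩
    intro s
    induction s using Nat.strong_induction_on with
    | _ s ih =>
      intro a b hs hb
      have hb' : (b : ℚ≥0) ≠ 0 := by positivity
      rcases Nat.eq_zero_or_pos a with rfl | ha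
      · exact ⟨0, by simp [ratOfNat]⟩
      · rcases le_or_gt b a with hab | hab
        · obtain ⟨c, rfl⟩ := Nat.exists_eq_add_of_le hab
          obtain ⟨n, hn⟩ := ih (c + b) (by omega) c b rfl hb
          refine ⟨2 * n + 1, ?_⟩
          rw [ratOfNat_odd, hn]
          push_cast
          field_simp
          ring
        · obtain ⟨c, rfl⟩ := Nat.exists_eq_add_of_lt hab
          obtain ⟨n, hn⟩ := ih (a + (c + 1)) (by omega) a (c + 1) rfl (by omega)
          refine ⟨2 * n, ?_⟩
          have hc : ((c + 1 : ℕ) : ℚ≥0) ≠ 0 := by positivity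
          rw [ratOfNat_even, hn]
          push_cast at hc ⊢
          field_simp
          ring

/-- The enumeration `ratOfNat`, as an equivalence. -/
noncomputable def ratEquiv : ℚ≥0 ≃ ℕ := (Equiv.ofBijective _ ratOfNat_bijective).symm

theorem ratEquiv_zero : ratEquiv 0 = 0 :=
  (Equiv.symm_apply_eq _).2 (by simp [ratOfNat])

/-- The number of a rational probability: `1` has the number `0`, and `x / (x + 1)` has the number
of `x` plus one. -/
noncomputable def Prob.toNat (p : Prob) : ℕ :=
  if (p : ℚ) = 1 then 0 else ratEquiv ((p : ℚ) / (1 - (p : ℚ))).toNNRat + 1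

/-- The inverse of `Prob.toNat`. -/
noncomputable def Prob.ofNat : ℕ → Prob
  | 0 => 1
  | n + 1 => ⟨(ratEquiv.symm n : ℚ) / ((ratEquiv.symm n : ℚ) + 1), by
      have h : (0 : ℚ) ≤ (ratEquiv.symm n : ℚ) := NNRat.cast_nonneg _
      exact ⟨by positivity, (div_le_one (by positivity)).2 (by linarith)⟩⟩

/-- The numbering of the rational probabilities. -/
noncomputable def probEquiv : Prob ≃ ℕ where
  toFun := Prob.toNat
  invFun := Prob.ofNat
  left_inv p := by
    obtain ⟨p, hp⟩ := p
    by_cases h : p = 1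
    · subst h; simp [Prob.toNat, Prob.ofNat]
    · have h1 : (0 : ℚ) < 1 - p := sub_pos.2 (lt_of_le_of_ne hp.2 h)
      simp only [Prob.toNat, h, if_false, Prob.ofNat, Equiv.symm_apply_apply]
      apply Subtype.ext
      have h2 : (0 : ℚ) ≤ p / (1 - p) := div_nonneg hp.1 h1.le
      change ((p / (1 - p)).toNNRat : ℚ) / (((p / (1 - p)).toNNRat : ℚ) + 1) = p
      rw [Rat.coe_toNNRat _ h2]
      field_simp
      ring
  right_inv n := by
    rcases n with _ | n
    · simp [Prob.toNat, Prob.ofNat]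
    · have h : (0 : ℚ) ≤ (ratEquiv.symm n : ℚ) := NNRat.cast_nonneg _
      have h1 : (ratEquiv.symm n : ℚ) / ((ratEquiv.symm n : ℚ) + 1) ≠ 1 := by
        rw [Ne, div_eq_one_iff_eq (by positivity)]
        linarith
      have h2 : (ratEquiv.symm n : ℚ) / ((ratEquiv.symm n : ℚ) + 1) /
          (1 - (ratEquiv.symm n : ℚ) / ((ratEquiv.symm n : ℚ) + 1)) = (ratEquiv.symm n : ℚ) := by
        have : (ratEquiv.symm n : ℚ) + 1 ≠ 0 := by positivity
        field_simp
        ring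
      simp [Prob.toNat, Prob.ofNat, h1, h2]

/-- The Gödel number of an arithmetical expression. -/
noncomputable def AExpr.toNat : AExpr → ℕ
  | const q => 5 * ratEquiv q
  | var v => 5 * v + 1
  | add e₁ e₂ => 5 * Nat.pair e₁.toNat e₂.toNat + 2
  | sub e₁ e₂ => 5 * Nat.pair e₁.toNat e₂.toNat + 3
  | mul e₁ e₂ => 5 * Nat.pair e₁.toNat e₂.toNat + 4

/-- The arithmetical expression with a given Gödel number. -/
noncomputable def AExpr.ofNat (n : ℕ) : AExpr :=
  if h₀ : n % 5 = 0 then const (ratEquiv.symm (n / 5))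
  else
    have h₁ : (n / 5).unpair.1 < n := lt_of_le_of_lt (Nat.unpair_left_le _) (by omega)
    have h₂ : (n / 5).unpair.2 < n := lt_of_le_of_lt (Nat.unpair_right_le _) (by omega)
    if n % 5 = 1 then var (n / 5)
    else if n % 5 = 2 then add (ofNat (n / 5).unpair.1) (ofNat (n / 5).unpair.2)
    else if n % 5 = 3 then sub (ofNat (n / 5).unpair.1) (ofNat (n / 5).unpair.2)
    else mul (ofNat (n / 5).unpair.1) (ofNat (n / 5).unpair.2)
  termination_by n

noncomputable instance : Denumerable AExpr := Denumerable.mk' {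
  toFun := AExpr.toNat
  invFun := AExpr.ofNat
  left_inv e := by
    induction e <;> rw [AExpr.toNat, AExpr.ofNat] <;> simp [Nat.add_mod, Nat.add_div, *]
  right_inv n := by
    induction n using Nat.strong_induction_on with
    | _ n ih =>
      rw [AExpr.ofNat]
      split_ifs with h₀ h₁ h₂ h₃
      · simp [AExpr.toNat]; omega
      · simp [AExpr.toNat]; omega
      all_goals
        have h₁ : (n / 5).unpair.1 < n := lt_of_le_of_lt (Nat.unpair_left_le _) (by omega)
        have h₂ : (n / 5).unpair.2 < n := lt_of_le_of_lt (Nat.unpair_right_le _) (by omega)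
        simp only [AExpr.toNat, ih _ h₁, ih _ h₂, Nat.pair_unpair]
        omega }

/-- The Gödel number of a Boolean expression. -/
noncomputable def BExpr.toNat : BExpr → ℕ
  | eq e₁ e₂ => 4 * Nat.pair (Encodable.encode e₁) (Encodable.encode e₂)
  | le e₁ e₂ => 4 * Nat.pair (Encodable.encode e₁) (Encodable.encode e₂) + 1
  | not b => 4 * b.toNat + 2
  | and b₁ b₂ => 4 * Nat.pair b₁.toNat b₂.toNat + 3

/-- The Boolean expression with a given Gödel number. -/
noncomputable def BExpr.ofNat (n : ℕ) : BExpr :=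
  if h₀ : n % 4 = 0 then
    eq (Denumerable.ofNat AExpr (n / 4).unpair.1) (Denumerable.ofNat AExpr (n / 4).unpair.2)
  else
    have h : n / 4 < n := by omega
    have h₁ : (n / 4).unpair.1 < n := lt_of_le_of_lt (Nat.unpair_left_le _) h
    have h₂ : (n / 4).unpair.2 < n := lt_of_le_of_lt (Nat.unpair_right_le _) h
    if n % 4 = 1 then
      le (Denumerable.ofNat AExpr (n / 4).unpair.1) (Denumerable.ofNat AExpr (n / 4).unpair.2)
    else if n % 4 = 2 then not (ofNat (n / 4))
    else and (ofNat (n / 4).unpair.1) (ofNat (n / 4).unpair.2)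
  termination_by n

noncomputable instance : Denumerable BExpr := Denumerable.mk' {
  toFun := BExpr.toNat
  invFun := BExpr.ofNat
  left_inv e := by
    induction e <;> rw [BExpr.toNat, BExpr.ofNat] <;> simp [Nat.add_mod, Nat.add_div, *]
  right_inv n := by
    induction n using Nat.strong_induction_on with
    | _ n ih =>
      rw [BExpr.ofNat]
      split_ifs with h₀ h₁ h₂
      · simp [BExpr.toNat]; omega
      · simp [BExpr.toNat]; omega
      · simp only [BExpr.toNat, ih (n / 4) (by omega)]
        omega
      · have h₁ : (n / 4).unpair.1 < n := lt_of_le_of_lt (Nat.unpair_left_le _) (by omega)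
        have h₂ : (n / 4).unpair.2 < n := lt_of_le_of_lt (Nat.unpair_right_le _) (by omega)
        simp only [BExpr.toNat, ih _ h₁, ih _ h₂, Nat.pair_unpair]
        omega }

/-- The Gödel number of a program. -/
noncomputable def Prog.toNat : Prog → ℕ
  | assign v e => 4 * Nat.pair v (Encodable.encode e)
  | seq P Q => 4 * Nat.pair P.toNat Q.toNat + 1
  | choice P p Q => 4 * Nat.pair (probEquiv p) (Nat.pair P.toNat Q.toNat) + 2
  | loop b P => 4 * Nat.pair (Encodable.encode b) P.toNat + 3

/-- The program with a given Gödel number. -/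
noncomputable def Prog.ofNat (n : ℕ) : Prog :=
  if h₀ : n % 4 = 0 then
    assign (n / 4).unpair.1 (Denumerable.ofNat AExpr (n / 4).unpair.2)
  else
    have h : n / 4 < n := by omega
    have h₁ : (n / 4).unpair.1 < n := lt_of_le_of_lt (Nat.unpair_left_le _) h
    have h₂ : (n / 4).unpair.2 < n := lt_of_le_of_lt (Nat.unpair_right_le _) h
    have h₃ : (n / 4).unpair.2.unpair.1 < n := lt_of_le_of_lt (Nat.unpair_left_le _) h₂
    have h₄ : (n / 4).unpair.2.unpair.2 < n := lt_of_le_of_lt (Nat.unpair_right_le _) h₂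
    if n % 4 = 1 then seq (ofNat (n / 4).unpair.1) (ofNat (n / 4).unpair.2)
    else if n % 4 = 2 then
      choice (ofNat (n / 4).unpair.2.unpair.1) (probEquiv.symm (n / 4).unpair.1)
        (ofNat (n / 4).unpair.2.unpair.2)
    else loop (Denumerable.ofNat BExpr (n / 4).unpair.1) (ofNat (n / 4).unpair.2)
  termination_by n

noncomputable instance : Denumerable Prog := Denumerable.mk' {
  toFun := Prog.toNat
  invFun := Prog.ofNat
  left_inv P := by
    induction P <;> rw [Prog.toNat, Prog.ofNat] <;> simp [Nat.add_mod, Nat.add_div, *]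
  right_inv n := by
    induction n using Nat.strong_induction_on with
    | _ n ih =>
      rw [Prog.ofNat]
      split_ifs with h₀
      · simp [Prog.toNat]; omega
      all_goals
        have h : n / 4 < n := by omega
        have h₁ : (n / 4).unpair.1 < n := lt_of_le_of_lt (Nat.unpair_left_le _) h
        have h₂ : (n / 4).unpair.2 < n := lt_of_le_of_lt (Nat.unpair_right_le _) h
        have h₃ : (n / 4).unpair.2.unpair.1 < n := lt_of_le_of_lt (Nat.unpair_left_le _) h₂
        have h₄ : (n / 4).unpair.2.unpair.2 < n := lt_of_le_of_lt (Nat.unpair_right_le _) h₂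
        simp only [Prog.toNat, ih _ h₁, ih _ h₂, ih _ h₃, ih _ h₄, Nat.pair_unpair,
          Denumerable.encode_ofNat, Equiv.apply_symm_apply]
        omega }

/-- The numbering of the valuations: a valuation is turned into a finitely supported function with
natural values by `ratEquiv`, hence into a finite multiset of natural numbers. -/
noncomputable instance : Denumerable Val := Denumerable.mk' <|
  ((Finsupp.mapRange.equiv ratEquiv ratEquiv_zero).trans
    Multiset.toFinsupp.symm.toEquiv).trans (Denumerable.eqv (Multiset ℕ))

noncomputable instance : Encodable Val := Denumerable.toEncodable

/-! ### The arithmetical hierarchy -/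

mutual

/-- `∃ y₁ ∀ y₂ ∃ y₃ ⋯ y_n, R [y₁, …, y_n]`, with alternating quantifiers. -/
def ExistsForall : ℕ → (List ℕ → Prop) → Prop
  | 0, R => R []
  | n + 1, R => ∃ y, ForallExists n fun ys => R (y :: ys)

/-- `∀ y₁ ∃ y₂ ∀ y₃ ⋯ y_n, R [y₁, …, y_n]`, with alternating quantifiers. -/
def ForallExists : ℕ → (List ℕ → Prop) → Prop
  | 0, R => R []
  | n + 1, R => ∀ y, ExistsForall n fun ys => R (y :: ys)

end

/-- The class `Σ_n^0`. -/
def IsSigma (n : ℕ) {α : Type} [Primcodable α] (A : α → Prop) : Prop :=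
  ∃ R : α × List ℕ → Prop, ComputablePred R ∧ ∀ x, A x ↔ ExistsForall n fun ys => R (x, ys)

/-- `A` is `Σ_n^0`-hard: every problem in `Σ_n^0` is many-one reducible to `A`. -/
def IsSigmaHard (n : ℕ) {α : Type} [Primcodable α] (A : α → Prop) : Prop :=
  ∀ (β : Type) [Primcodable β] (C : β → Prop), IsSigma n C → ManyOneReducible C A

/-- `A` is `Σ_n^0`-complete. -/
def IsSigmaComplete (n : ℕ) {α : Type} [Primcodable α] (A : α → Prop) : Prop :=
  IsSigma n A ∧ IsSigmaHard n A

end PGCL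

open scoped NNRat ENNReal

namespace PGCL

/-! ### The expected running time as a supremum -/

/-- The possible successors of a configuration, with their probabilities. -/
noncomputable def succs : Cmd → Val → List (ℚ × Cmd × Val)
  | .term, _ => []
  | .assign v e, η => [(1, .term, assignVal η v (e.eval η))]
  | .seq .term P, η => [(1, P.toCmd, η)]
  | .seq C P, η => (succs C η).map fun r => (r.1, .seq r.2.1 P, r.2.2)
  | .choice P p Q, η => [((p : ℚ), P.toCmd, η), (1 - (p : ℚ), Q.toCmd, η)]
  | .loop b P, η => if b.eval η then [(1, .seq P.toCmd (.loop b P), η)] else [(1, .term, η)]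

theorem succs_seq (C : Cmd) (hC : C ≠ .term) (P : Prog) (η : Val) :
    succs (.seq C P) η = (succs C η).map fun r => (r.1, .seq r.2.1 P, r.2.2) := by
  cases C <;> simp_all [succs]

/-- A configuration is terminal, or it has one successor, or a probabilistic choice is due. -/
theorem succs_cases (C : Cmd) (η : Val) :
    C = .term ∨
    (C ≠ .term ∧ ∃ C' η', succs C η = [(1, C', η')] ∧
      ∀ a θ w, next C η a θ w = some (⟨C', η', a, θ⟩, w)) ∨
    (C ≠ .term ∧ ∃ (p : Prob) (C₁ C₂ : Cmd),
      succs C η = [((p : ℚ), C₁, η), (1 - (p : ℚ), C₂, η)] ∧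
      ∀ a θ w, next C η a θ [] = none ∧
        next C η a θ (.L :: w) = some (⟨C₁, η, a * p, θ ++ [.L]⟩, w) ∧
        next C η a θ (.R :: w) = some (⟨C₂, η, a * p.compl, θ ++ [.R]⟩, w)) := by
  induction C with
  | term => exact .inl rfl
  | assign v e => exact .inr (.inl ⟨by simp, _, _, rfl, fun _ _ _ => rfl⟩)
  | seq C P ih =>
    right
    rcases ih with rfl | ⟨hC, C', η', h, hn⟩ | ⟨hC, p, C₁, C₂, h, hn⟩
    · exact .inl ⟨by simp, _, _, rfl, fun _ _ _ => rfl⟩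
    · exact .inl ⟨by simp, .seq C' P, η', by simp [succs_seq C hC, h],
        fun a θ w => by simp [next_seq C hC, hn]⟩
    · exact .inr ⟨by simp, p, .seq C₁ P, .seq C₂ P, by simp [succs_seq C hC, h],
        fun a θ w => by simp [next_seq C hC, (hn a θ w).1, (hn a θ w).2.1, (hn a θ w).2.2]⟩
  | choice P p Q =>
    exact .inr (.inr ⟨by simp, p, _, _, rfl, fun a θ w => ⟨rfl, rfl, rfl⟩⟩)
  | loop b P =>
    right; left
    cases h : b.eval η
    · exact ⟨by simp, .term, η, by simp [succs, h], fun a θ w => by simp [next, h]⟩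
    · exact ⟨by simp, .seq P.toCmd (.loop b P), η, by simp [succs, h],
        fun a θ w => by simp [next, h]⟩

/-- The mean of `F` over a weighted list of configurations. -/
def mean (F : Cmd → Val → ℚ) (D : List (ℚ × Cmd × Val)) : ℚ :=
  (D.map fun r => r.1 * F r.2.1 r.2.2).sum

open Classical in
/-- The probability of termination after exactly `k` steps. -/
noncomputable def termAt : ℕ → Cmd → Val → ℚ
  | 0, C, _ => if C = .term then 1 else 0
  | k + 1, C, η => mean (termAt k) (succs C η)

/-- The sum of `F w` over the words `w` with fewer than `m` letters. -/
def wordSum (m : ℕ) (F : List Dir → ℚ) : ℚ :=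
  ∑ i ∈ Finset.range m, ∑ w : Fin i → Dir, F (List.ofFn w)

theorem wordSum_succ (m : ℕ) (F : List Dir → ℚ) :
    wordSum (m + 1) F = F [] + wordSum m (fun w => F (.L :: w)) + wordSum m (fun w => F (.R :: w)) := by
  unfold wordSum
  rw [Finset.sum_range_succ']
  have h : ∀ i : ℕ, ∑ w : Fin (i + 1) → Dir, F (List.ofFn w) =
      ∑ w : Fin i → Dir, F (.L :: List.ofFn w) + ∑ w : Fin i → Dir, F (.R :: List.ofFn w) := by
    intro i
    rw [← (Fin.consEquiv fun _ : Fin (i + 1) => Dir).sum_comp, Fintype.sum_prod_type]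
    have : (Finset.univ : Finset Dir) = {.L, .R} := rfl
    rw [this, Finset.sum_pair (by decide)]
    simp [Fin.consEquiv, List.ofFn_succ]
  simp only [h, Finset.sum_add_distrib]
  simp
  ring

theorem wordSum_zero_fun (m : ℕ) : wordSum m (fun _ => 0) = 0 := by simp [wordSum]

theorem T_zero (σ : State) (w : List Dir) : T 0 σ w = if w = [] then some σ else none := rfl

theorem T_succ (k : ℕ) (σ : State) (w : List Dir) :
    T (k + 1) σ w = (next σ.cmd σ.val σ.prob σ.hist w).bind fun r => T k r.1 r.2 := rfl

theorem wordSum_alpha (k m : ℕ) (hm : k < m) (C : Cmd) (η : Val) (a : Prob) (θ : List Dir) :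
    wordSum m (fun w => alpha (T k ⟨C, η, a, θ⟩ w)) = a * termAt k C η := by
  induction k generalizing m C η a θ with
  | zero =>
    obtain ⟨m, rfl⟩ := Nat.exists_eq_succ_of_ne_zero (Nat.ne_of_gt hm)
    rw [wordSum_succ]
    simp only [T_zero]
    cases C <;> simp [alpha, wordSum_zero_fun, termAt]
  | succ k ih =>
    simp only [T_succ]
    rcases succs_cases C η with rfl | ⟨-, C', η', h, hn⟩ | ⟨-, p, C₁, C₂, h, hn⟩
    · simp [next, alpha, wordSum_zero_fun, termAt, succs, mean]
    · simp only [hn, Option.bind_some, ih m (by omega), termAt, mean, h]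
      simp
    · obtain ⟨m, rfl⟩ := Nat.exists_eq_succ_of_ne_zero (Nat.ne_of_gt (Nat.zero_lt_of_lt hm))
      rw [wordSum_succ]
      have h₁ := fun w => (hn a θ w).1
      have h₂ := fun w => (hn a θ w).2.1
      have h₃ := fun w => (hn a θ w).2.2
      simp only [h₁ [], h₂, h₃, Option.bind_some, Option.bind_none, ih m (by omega), termAt, mean, h]
      simp [alpha, Prob.compl]
      ring

theorem terminatesAt_eq (P : Prog) (η : Val) (k : ℕ) :
    terminatesAt P η k = termAt k P.toCmd η := by
  have := wordSum_alpha k (k + 1) (by omega) P.toCmd η 1 []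
  simpa [wordSum, terminatesAt, initState] using this

/-- The probability of running for more than `k` steps. -/
noncomputable def surv (k : ℕ) (C : Cmd) (η : Val) : ℚ :=
  1 - ∑ j ∈ Finset.range (k + 1), termAt j C η

/-- The expected running time, truncated after `n` steps. -/
noncomputable def En (n : ℕ) (C : Cmd) (η : Val) : ℚ :=
  ∑ k ∈ Finset.range n, surv k C η

theorem termAt_succ_term (k : ℕ) (η : Val) : termAt (k + 1) .term η = 0 := by
  simp [termAt, succs, mean]

theorem surv_term (k : ℕ) (η : Val) : surv k .term η = 0 := by
  rw [surv, Finset.sum_range_succ']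
  simp only [termAt_succ_term]
  simp [termAt]

theorem surv_zero (C : Cmd) (hC : C ≠ .term) (η : Val) : surv 0 C η = 1 := by
  simp [surv, termAt, hC]

theorem surv_succ (k : ℕ) (C : Cmd) (hC : C ≠ .term) (η : Val) :
    surv (k + 1) C η = mean (surv k) (succs C η) := by
  rw [surv, Finset.sum_range_succ']
  rcases succs_cases C η with rfl | ⟨-, C', η', h, -⟩ | ⟨-, p, C₁, C₂, h, -⟩
  · exact absurd rfl hC
  · simp [termAt, hC, mean, h, surv]
  · simp [termAt, hC, mean, h, surv, Finset.sum_add_distrib, ← Finset.mul_sum]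
    ring

theorem surv_mem (k : ℕ) (C : Cmd) (η : Val) : 0 ≤ surv k C η ∧ surv k C η ≤ 1 := by
  induction k generalizing C η with
  | zero =>
    by_cases hC : C = .term
    · subst hC; simp [surv_term]
    · simp [surv_zero C hC]
  | succ k ih =>
    by_cases hC : C = .term
    · subst hC; simp [surv_term]
    rw [surv_succ k C hC]
    rcases succs_cases C η with rfl | ⟨-, C', η', h, -⟩ | ⟨-, p, C₁, C₂, h, -⟩
    · exact absurd rfl hC
    · simpa [mean, h] using ih C' η'
    · obtain ⟨p, hp₀, hp₁⟩ := p
      have h₁ := ih C₁ η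
      have h₂ := ih C₂ η
      simp only [mean, h, List.map_cons, List.map_nil, List.sum_cons, List.sum_nil, add_zero]
      constructor <;> nlinarith [mul_nonneg hp₀ h₁.1, mul_nonneg (sub_nonneg.2 hp₁) h₂.1]

theorem En_zero (C : Cmd) (η : Val) : En 0 C η = 0 := by simp [En]

theorem En_term (n : ℕ) (η : Val) : En n .term η = 0 := by simp [En, surv_term]

theorem En_succ (n : ℕ) (C : Cmd) (hC : C ≠ .term) (η : Val) :
    En (n + 1) C η = 1 + mean (En n) (succs C η) := by
  rw [En, Finset.sum_range_succ', surv_zero C hC, add_comm]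
  simp only [surv_succ _ C hC]
  rcases succs_cases C η with rfl | ⟨-, C', η', h, -⟩ | ⟨-, p, C₁, C₂, h, -⟩
  · exact absurd rfl hC
  · simp [mean, h, En]
  · simp [mean, h, En, Finset.sum_add_distrib, ← Finset.mul_sum]

theorem En_nonneg (n : ℕ) (C : Cmd) (η : Val) : 0 ≤ En n C η :=
  Finset.sum_nonneg fun k _ => (surv_mem k C η).1

theorem En_le (n : ℕ) (C : Cmd) (η : Val) : En n C η ≤ n := by
  simpa [En] using Finset.sum_le_card_nsmul (Finset.range n) (fun k => surv k C η) 1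
    fun k _ => (surv_mem k C η).2

theorem En_mono {m n : ℕ} (h : m ≤ n) (C : Cmd) (η : Val) : En m C η ≤ En n C η :=
  Finset.sum_le_sum_of_subset_of_nonneg (by simpa using h) fun k _ _ => (surv_mem k C η).1

theorem past_iff (P : Prog) (η : Val) : PAST (P, η) ↔ ∃ c : ℕ, ∀ n, En n P.toCmd η ≤ c := by
  have key : ∀ n, ∑ k ∈ Finset.range n, ENNReal.ofReal (1 - (terminatesWithin P η k : ℝ)) =
      ENNReal.ofReal (En n P.toCmd η : ℝ) := by
    intro n
    rw [En, Rat.cast_sum, ENNReal.ofReal_sum_of_nonneg]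
    · simp [surv, terminatesWithin, terminatesAt_eq]
    · intro k _
      exact_mod_cast (surv_mem k _ _).1
  have hE : expectedTime P η = ⨆ n, ENNReal.ofReal (En n P.toCmd η : ℝ) := by
    rw [expectedTime, ENNReal.tsum_eq_iSup_nat]
    simp only [key]
  unfold PAST
  rw [hE]
  constructor
  · intro h
    obtain ⟨c, hc⟩ := ENNReal.exists_nat_gt h.ne
    refine ⟨c, fun n => ?_⟩
    have h₁ := (le_iSup (fun n => ENNReal.ofReal (En n P.toCmd η : ℝ)) n).trans hc.le
    rw [ENNReal.ofReal_le_natCast] at h₁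
    exact_mod_cast h₁
  · rintro ⟨c, hc⟩
    refine lt_of_le_of_lt (iSup_le fun n => ?_) (ENNReal.natCast_lt_top c)
    rw [ENNReal.ofReal_le_natCast]
    exact_mod_cast hc n

/-! ### Continuations -/

/-- The command `C`, followed by the programs of a list. -/
def plug (C : Cmd) (l : List Prog) : Cmd := l.foldl .seq C

@[simp] theorem plug_nil (C : Cmd) : plug C [] = C := rfl

@[simp] theorem plug_cons (C : Cmd) (P : Prog) (l : List Prog) :
    plug C (P :: l) = plug (.seq C P) l := rfl

theorem plug_ne_term (C : Cmd) (hC : C ≠ .term) (l : List Prog) : plug C l ≠ .term := by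
  induction l generalizing C with
  | nil => exact hC
  | cons P l ih => exact ih _ (by simp)

theorem succs_plug (C : Cmd) (hC : C ≠ .term) (l : List Prog) (η : Val) :
    succs (plug C l) η = (succs C η).map fun r => (r.1, plug r.2.1 l, r.2.2) := by
  induction l generalizing C with
  | nil => simp
  | cons P l ih => simp [ih _ (show Cmd.seq C P ≠ .term by simp), succs_seq C hC]

theorem En_plug_succ (n : ℕ) (C : Cmd) (hC : C ≠ .term) (l : List Prog) (η : Val) :
    En (n + 1) (plug C l) η = 1 + mean (fun C' => En n (plug C' l)) (succs C η) := by
  rw [En_succ _ _ (plug_ne_term C hC l), succs_plug C hC]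
  simp [mean, Function.comp_def]

theorem En_plug_term_cons (n : ℕ) (Q : Prog) (l : List Prog) (η : Val) :
    En (n + 1) (plug .term (Q :: l)) η = 1 + En n (plug Q.toCmd l) η := by
  rw [plug_cons, En_plug_succ _ _ (by simp)]
  simp [mean, succs]

theorem En_plug_assign (n : ℕ) (v : Var) (e : AExpr) (l : List Prog) (η : Val) :
    En (n + 1) (plug (Prog.assign v e).toCmd l) η =
      1 + En n (plug .term l) (assignVal η v (e.eval η)) := by
  rw [Prog.toCmd, En_plug_succ _ _ (by simp)]
  simp [mean, succs]

theorem plug_seq (P Q : Prog) (l : List Prog) :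
    plug (Prog.seq P Q).toCmd l = plug P.toCmd (Q :: l) := rfl

theorem En_plug_choice (n : ℕ) (P : Prog) (p : Prob) (Q : Prog) (l : List Prog) (η : Val) :
    En (n + 1) (plug (Prog.choice P p Q).toCmd l) η =
      1 + ((p : ℚ) * En n (plug P.toCmd l) η + (1 - (p : ℚ)) * En n (plug Q.toCmd l) η) := by
  rw [Prog.toCmd, En_plug_succ _ _ (by simp)]
  simp [mean, succs]

theorem En_plug_loop_true (n : ℕ) (b : BExpr) (P : Prog) (l : List Prog) (η : Val)
    (h : b.eval η = true) :
    En (n + 1) (plug (Prog.loop b P).toCmd l) η = 1 + En n (plug P.toCmd (.loop b P :: l)) η := by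
  rw [Prog.toCmd, En_plug_succ _ _ (by simp)]
  simp [mean, succs, h]

theorem En_plug_loop_false (n : ℕ) (b : BExpr) (P : Prog) (l : List Prog) (η : Val)
    (h : b.eval η = false) :
    En (n + 1) (plug (Prog.loop b P).toCmd l) η = 1 + En n (plug .term l) η := by
  rw [Prog.toCmd, En_plug_succ _ _ (by simp)]
  simp [mean, succs, h]

theorem assignVal_apply (η : Val) (v : ℕ) (q : ℚ) (u : ℕ) :
    assignVal η v q u = if u = v then q.toNNRat else η u := by
  simp [assignVal, Finsupp.update_apply]

/-! ### Upper bounds for one step -/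

theorem En_plug_term_cons_le (n : ℕ) (Q : Prog) (l : List Prog) (η : Val) :
    En n (plug .term (Q :: l)) η ≤ 1 + En n (plug Q.toCmd l) η := by
  have h := En_plug_term_cons n Q l η
  have := En_mono (Nat.le_succ n) (plug .term (Q :: l)) η
  linarith

theorem En_plug_assign_le (n : ℕ) (v : Var) (e : AExpr) (l : List Prog) (η : Val) :
    En n (plug (Prog.assign v e).toCmd l) η ≤
      1 + En n (plug .term l) (assignVal η v (e.eval η)) := by
  have h := En_plug_assign n v e l η
  have := En_mono (Nat.le_succ n) (plug (Prog.assign v e).toCmd l) η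
  linarith

theorem En_plug_choice_le (n : ℕ) (P : Prog) (p : Prob) (Q : Prog) (l : List Prog) (η : Val) :
    En n (plug (Prog.choice P p Q).toCmd l) η ≤
      1 + ((p : ℚ) * En n (plug P.toCmd l) η + (1 - (p : ℚ)) * En n (plug Q.toCmd l) η) := by
  have h := En_plug_choice n P p Q l η
  have := En_mono (Nat.le_succ n) (plug (Prog.choice P p Q).toCmd l) η
  linarith

theorem En_plug_loop_true_le (n : ℕ) (b : BExpr) (P : Prog) (l : List Prog) (η : Val)
    (hb : b.eval η = true) :
    En n (plug (Prog.loop b P).toCmd l) η ≤ 1 + En n (plug P.toCmd (.loop b P :: l)) η := by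
  have h := En_plug_loop_true n b P l η hb
  have := En_mono (Nat.le_succ n) (plug (Prog.loop b P).toCmd l) η
  linarith

theorem En_plug_loop_false_le (n : ℕ) (b : BExpr) (P : Prog) (l : List Prog) (η : Val)
    (hb : b.eval η = false) :
    En n (plug (Prog.loop b P).toCmd l) η ≤ 1 + En n (plug .term l) η := by
  have h := En_plug_loop_false n b P l η hb
  have := En_mono (Nat.le_succ n) (plug (Prog.loop b P).toCmd l) η
  linarith

/-! ### Runs in which all choices are resolved to the left -/

/-- The probability `1/2`. -/
def Prob.half : Prob := ⟨1 / 2, by norm_num, by norm_num⟩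

theorem Prob.coe_half : ((Prob.half : Prob) : ℚ) = 1 / 2 := rfl

/-- `Big P η c η'`: if all choices are resolved to the left, then `P` turns `η` into `η'`, after
`c` choices, all of which are fair. -/
inductive Big : Prog → Val → ℕ → Val → Prop
  | assign (v e η) : Big (.assign v e) η 0 (assignVal η v (e.eval η))
  | seq {P Q η₁ η₂ η₃ c d} : Big P η₁ c η₂ → Big Q η₂ d η₃ → Big (.seq P Q) η₁ (c + d) η₃
  | choice {P Q η η' c} : Big P η c η' → Big (.choice P .half Q) η (c + 1) η'
  | loop_false {b P η} : b.eval η = false → Big (.loop b P) η 0 η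
  | loop_true {b P η₁ η₂ η₃ c d} : b.eval η₁ = true → Big P η₁ c η₂ →
      Big (.loop b P) η₂ d η₃ → Big (.loop b P) η₁ (c + d) η₃

theorem Big.lower {P : Prog} {η η' : Val} {c : ℕ} (h : Big P η c η') :
    ∃ t, ∀ n l, (1 / 2) ^ c * En n (plug .term l) η' ≤ En (n + t) (plug P.toCmd l) η := by
  induction h with
  | assign v e η =>
    refine ⟨1, fun n l => ?_⟩
    rw [En_plug_assign]
    linarith
  | @seq P Q η₁ η₂ η₃ c d _ _ ih₁ ih₂ =>
    obtain ⟨s, hs⟩ := ih₁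
    obtain ⟨t, ht⟩ := ih₂
    refine ⟨t + 1 + s, fun n l => ?_⟩
    rw [plug_seq, show n + (t + 1 + s) = n + t + 1 + s by ring]
    refine le_trans ?_ (hs (n + t + 1) (Q :: l))
    rw [En_plug_term_cons, pow_add, mul_assoc]
    gcongr
    exact (ht n l).trans (by linarith)
  | @choice P Q η η' c _ ih =>
    obtain ⟨t, ht⟩ := ih
    refine ⟨t + 1, fun n l => ?_⟩
    rw [← add_assoc, En_plug_choice, Prob.coe_half, pow_succ]
    have := En_nonneg (n + t) (plug Q.toCmd l) η
    linarith [ht n l]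
  | loop_false hb =>
    refine ⟨1, fun n l => ?_⟩
    rw [En_plug_loop_false _ _ _ _ _ hb]
    linarith
  | @loop_true b P η₁ η₂ η₃ c d hb _ _ ih₁ ih₂ =>
    obtain ⟨s, hs⟩ := ih₁
    obtain ⟨t, ht⟩ := ih₂
    refine ⟨t + 1 + s + 1, fun n l => ?_⟩
    rw [show n + (t + 1 + s + 1) = n + t + 1 + s + 1 by ring, En_plug_loop_true _ _ _ _ _ hb]
    refine le_trans ?_ ((hs (n + t + 1) (.loop b P :: l)).trans (by linarith))
    rw [En_plug_term_cons, pow_add, mul_assoc]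
    gcongr
    exact (ht n l).trans (by linarith)

/-! ### Loops that stop with probability 1/2 in every iteration

The variable `0` is a flag that is raised when all loops have to be left, and the variable `1` is
doubled whenever the flag might have been raised. -/

/-- `{v₁ := 2 * v₁} [1/2] {v₀ := 1}`. -/
def coin : Prog :=
  .choice (.assign 1 (.mul (.const 2) (.var 1))) .half (.assign 0 (.const 1))

/-- A loop that is left when the flag is raised, and which tosses a coin in every iteration. -/
def iloop (b : BExpr) (P : Prog) : Prog :=
  .loop (.and b (.eq (.var 0) (.const 0))) (.seq coin P)

/-- Programs of which all loops toss a coin in every iteration. -/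
inductive Instr : Prog → Prop
  | assign {v : ℕ} (e : AExpr) : 2 ≤ v → Instr (.assign v e)
  | seq {P Q} : Instr P → Instr Q → Instr (.seq P Q)
  | iloop (b : BExpr) {P} : Instr P → Instr (iloop b P)

theorem guard_eval (b : BExpr) (η : Val) :
    (BExpr.and b (.eq (.var 0) (.const 0))).eval η = (b.eval η && decide (η 0 = 0)) := by
  simp [BExpr.eval, AExpr.eval]

/-- The effect of `coin`, if the flag is not raised. -/
noncomputable def dbl (η : Val) : Val := assignVal η 1 (2 * (η 1 : ℚ))

theorem dbl_one (η : Val) : dbl η 1 = 2 * η 1 := by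
  rw [dbl, assignVal_apply, if_pos rfl]
  apply NNRat.coe_injective
  rw [Rat.coe_toNNRat _ (by positivity)]
  simp

theorem dbl_of_ne (η : Val) {v : ℕ} (hv : v ≠ 1) : dbl η v = η v := by
  rw [dbl, assignVal_apply, if_neg hv]

theorem Big.coin (η : Val) : Big coin η 1 (dbl η) := .choice (.assign _ _ _)

theorem Big.of_coin {η η' : Val} {c : ℕ} (h : Big PGCL.coin η c η') : c = 1 ∧ η' = dbl η := by
  cases h with
  | choice h => cases h; exact ⟨rfl, rfl⟩

theorem Instr.frame {P : Prog} (hP : Instr P) {η η' : Val} {c : ℕ} (h : Big P η c η') :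
    η' 0 = η 0 ∧ η' 1 = 2 ^ c * η 1 := by
  induction hP generalizing η η' c with
  | @assign v e hv =>
    cases h
    have h₀ : (0 : ℕ) ≠ v := by omega
    have h₁ : (1 : ℕ) ≠ v := by omega
    simp [assignVal_apply, h₀, h₁]
  | seq _ _ ih₁ ih₂ =>
    cases h with
    | seq h₁ h₂ =>
      have h₁ := ih₁ h₁
      have h₂ := ih₂ h₂
      exact ⟨h₂.1.trans h₁.1, by rw [h₂.2, h₁.2, pow_add]; ring⟩
  | @iloop b P _ ih =>
    generalize hQ : PGCL.iloop b P = Q at h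
    induction h with
    | loop_false => simp
    | @loop_true b' P' η₁ η₂ η₃ c d _ h₁ _ _ ih₂ =>
      cases hQ
      cases h₁ with
      | seq hc h₁ =>
        obtain ⟨rfl, rfl⟩ := hc.of_coin
        have h₁ := ih h₁
        have h₂ := ih₂ rfl
        refine ⟨by rw [h₂.1, h₁.1, dbl_of_ne _ (by decide)], ?_⟩
        rw [h₂.2, h₁.2, dbl_one, pow_add, pow_add]
        ring
    | _ => cases hQ

/-- An upper bound for the expected running time of `P` before a continuation, in terms of a bound
for the running time of the continuation after a run in which the flag has been raised. -/
structure Bounded (P : Prog) (K : ℚ) : Prop where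
  one_le : 1 ≤ K
  fast : ∀ (n : ℕ) (l : List Prog) (B : ℚ), 0 ≤ B →
    (∀ ζ : Val, ζ 0 = 1 → En n (plug .term l) ζ ≤ B) →
    ∀ η : Val, η 0 = 1 → En n (plug P.toCmd l) η ≤ K * (1 + B)
  upper : ∀ (n : ℕ) (l : List Prog) (B : ℚ), 0 ≤ B →
    (∀ ζ : Val, ζ 0 = 1 → En n (plug .term l) ζ ≤ B) →
    ∀ (η η' : Val) (c : ℕ), η 0 = 0 → Big P η c η' →
      En n (plug P.toCmd l) η ≤ K * (1 + B) + (1 / 2) ^ c * En n (plug .term l) η'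

theorem Bounded.assign {v : Var} (e : AExpr) (hv : v ≠ 0) : Bounded (.assign v e) 1 where
  one_le := le_rfl
  fast n l B hB h η hη := by
    refine (En_plug_assign_le _ _ _ _ _).trans ?_
    have := h (assignVal η v (e.eval η)) (by rwa [assignVal_apply, if_neg hv.symm])
    linarith
  upper n l B hB h η η' c hη hr := by
    cases hr
    refine (En_plug_assign_le _ _ _ _ _).trans ?_
    linarith

theorem Bounded.coin : Bounded coin 2 where
  one_le := by norm_num
  fast n l B hB h η hη := by
    refine (En_plug_choice_le _ _ _ _ _ _).trans ?_
    rw [Prob.coe_half]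
    have h₁ := En_plug_assign_le n 1 (.mul (.const 2) (.var 1)) l η
    have h₂ := En_plug_assign_le n 0 (.const 1) l η
    have h₃ := h (assignVal η 1 (AExpr.eval (.mul (.const 2) (.var 1)) η))
      (by rwa [assignVal_apply, if_neg (by decide)])
    have h₄ := h (assignVal η 0 (AExpr.eval (.const 1) η)) (by simp [assignVal_apply, AExpr.eval])
    linarith
  upper n l B hB h η η' c hη hr := by
    obtain ⟨rfl, rfl⟩ := hr.of_coin
    refine (En_plug_choice_le _ _ _ _ _ _).trans ?_
    rw [Prob.coe_half]
    have h₁ := En_plug_assign_le n 1 (.mul (.const 2) (.var 1)) l η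
    have h₂ := En_plug_assign_le n 0 (.const 1) l η
    have h₃ : assignVal η 1 (AExpr.eval (.mul (.const 2) (.var 1)) η) = dbl η := rfl
    have h₄ := h (assignVal η 0 (AExpr.eval (.const 1) η)) (by simp [assignVal_apply, AExpr.eval])
    rw [h₃] at h₁
    linarith

theorem Bounded.seq {P Q : Prog} {K₁ K₂ : ℚ} (hP : Bounded P K₁) (hQ : Bounded Q K₂)
    (hf : ∀ η c η', Big P η c η' → η' 0 = η 0) :
    Bounded (.seq P Q) (K₁ * (2 + K₂) + 1 + K₂) where
  one_le := by nlinarith [hP.one_le, hQ.one_le]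
  fast n l B hB h η hη := by
    have h₁ := hP.one_le
    have h₂ := hQ.one_le
    have h₃ := hQ.fast n l B hB h
    rw [plug_seq]
    have := hP.fast n (Q :: l) (1 + K₂ * (1 + B)) (by positivity)
      (fun ζ hζ => (En_plug_term_cons_le _ _ _ _).trans (by linarith [h₃ ζ hζ])) η hη
    nlinarith [mul_nonneg (zero_le_one.trans h₁) hB]
  upper n l B hB h η η' c hη hr := by
    cases hr with
    | @seq _ _ _ η₁ _ c d hr₁ hr₂ =>
      have h₁ := hP.one_le
      have h₂ := hQ.one_le
      have h₃ := hQ.fast n l B hB h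
      have h₄ := hQ.upper n l B hB h η₁ η' d ((hf _ _ _ hr₁).trans hη) hr₂
      have h₅ := hP.upper n (Q :: l) (1 + K₂ * (1 + B)) (by positivity)
        (fun ζ hζ => (En_plug_term_cons_le _ _ _ _).trans (by linarith [h₃ ζ hζ])) η η₁ c hη hr₁
      rw [plug_seq, pow_add, mul_assoc]
      set x : ℚ := (1 / 2) ^ c
      have hx₀ : 0 ≤ x := by positivity
      have hx₁ : x ≤ 1 := pow_le_one₀ (by norm_num) (by norm_num)
      have h₆ := mul_le_mul_of_nonneg_left
        ((En_plug_term_cons_le n Q l η₁).trans (add_le_add_right h₄ 1)) hx₀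
      have h₇ : x * (1 + K₂ * (1 + B)) ≤ 1 * (1 + K₂ * (1 + B)) :=
        mul_le_mul_of_nonneg_right hx₁ (by positivity)
      nlinarith [mul_nonneg (zero_le_one.trans h₁) hB]

theorem Bounded.loop {b : BExpr} {P : Prog} {K : ℚ} (hP : Bounded P K)
    (hb : ∀ η : Val, η 0 = 1 → b.eval η = false)
    (hf : ∀ η c η', Big P η c η' → 1 ≤ c ∧ η' 0 = η 0) :
    Bounded (.loop b P) (6 * K + 4) where
  one_le := by linarith [hP.one_le]
  fast n l B hB h η hη := by
    have := En_plug_loop_false_le n b P l η (hb η hη)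
    nlinarith [h η hη, hP.one_le]
  upper n l B hB h η η' c hη hr := by
    have hK := hP.one_le
    generalize hQ : Prog.loop b P = Q at hr
    induction hr with
    | @loop_false b' P' η hb' =>
      cases hQ
      have := En_plug_loop_false_le n b P l η hb'
      nlinarith
    | @loop_true b' P' η₁ η₂ η₃ c d hb' hr _ _ ih =>
      cases hQ
      obtain ⟨hc, hz⟩ := hf _ _ _ hr
      have h₁ := En_plug_loop_true_le n b P l η₁ hb'
      have h₂ := hP.upper n (.loop b P :: l) (2 + B) (by positivity) (fun ζ hζ => by
        have h₁ := En_plug_term_cons_le n (.loop b P) l ζ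
        have h₂ := En_plug_loop_false_le n b P l ζ (hb ζ hζ)
        linarith [h ζ hζ]) η₁ η₂ c hη hr
      have h₃ := (En_plug_term_cons_le n (.loop b P) l η₂).trans
        (add_le_add_right (ih (hz.trans hη) rfl) 1)
      rw [pow_add, mul_assoc]
      set x : ℚ := (1 / 2) ^ c
      have hx₀ : 0 ≤ x := by positivity
      have hx₁ : x ≤ 1 / 2 := by
        simpa only [pow_one] using pow_le_pow_of_le_one (by norm_num : (0 : ℚ) ≤ 1 / 2) (by norm_num) hc
      have h₄ := mul_le_mul_of_nonneg_left h₃ hx₀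
      have h₅ : x * (1 + (6 * K + 4) * (1 + B)) ≤ 1 / 2 * (1 + (6 * K + 4) * (1 + B)) :=
        mul_le_mul_of_nonneg_right hx₁ (by positivity)
      nlinarith [mul_nonneg (zero_le_one.trans hK) hB]
    | _ => cases hQ

theorem Instr.bounded {P : Prog} (hP : Instr P) : ∃ K, Bounded P K := by
  induction hP with
  | @assign v e hv => exact ⟨1, .assign e (show v ≠ (0 : ℕ) by omega)⟩
  | seq h₁ _ ih₁ ih₂ =>
    obtain ⟨K₁, h₁'⟩ := ih₁
    obtain ⟨K₂, h₂⟩ := ih₂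
    exact ⟨_, h₁'.seq h₂ fun _ _ _ h => (h₁.frame h).1⟩
  | iloop b h ih =>
    obtain ⟨K, hK⟩ := ih
    refine ⟨_, (Bounded.coin.seq hK ?_).loop ?_ ?_⟩
    · intro η c η' hr
      obtain ⟨rfl, rfl⟩ := hr.of_coin
      exact dbl_of_ne _ (by decide)
    · intro η hη
      simp [guard_eval, hη]
    · intro η c η' hr
      cases hr with
      | seq hc hr =>
        obtain ⟨rfl, rfl⟩ := hc.of_coin
        exact ⟨by omega, (h.frame hr).1.trans (dbl_of_ne _ (by decide))⟩

/-! ### Computation of primitive recursive functions -/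

/-- The run of `P` on `η` in which all choices are resolved to the left ends in `R`. -/
def Exec (P : Prog) (η : Val) (R : Val → Prop) : Prop := ∃ c η', Big P η c η' ∧ R η'

theorem Exec.mono {P : Prog} {η : Val} {R S : Val → Prop} (h : Exec P η R)
    (hRS : ∀ η', R η' → S η') : Exec P η S :=
  let ⟨c, η', hr, hR⟩ := h
  ⟨c, η', hr, hRS _ hR⟩

theorem Exec.assign {v : ℕ} {e : AExpr} {η : Val} {R : Val → Prop} (m : ℕ)
    (h : (e.eval η).toNNRat = m)
    (hR : ∀ η' : Val, η' v = m → (∀ u : ℕ, u ≠ v → η' u = η u) → R η') :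
    Exec (.assign v e) η R :=
  ⟨0, _, .assign v e η, hR _ (by simp [assignVal_apply, h])
    fun u hu => by rw [assignVal_apply, if_neg hu]⟩

theorem Exec.seq {P Q : Prog} {η : Val} {R : Val → Prop}
    (h : Exec P η fun η' => Exec Q η' R) : Exec (.seq P Q) η R :=
  let ⟨_, _, h₁, _, _, h₂, hR⟩ := h
  ⟨_, _, .seq h₁ h₂, hR⟩

theorem Exec.iloop {b : BExpr} {P : Prog} (I : ℕ → Val → Prop)
    (hstep : ∀ m η, I (m + 1) η → b.eval η = true ∧ η 0 = 0 ∧ Exec P (dbl η) (I m))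
    (hend : ∀ η, I 0 η → b.eval η = false) (m : ℕ) (η : Val) (h : I m η) :
    Exec (iloop b P) η (I 0) := by
  induction m generalizing η with
  | zero => exact ⟨0, η, .loop_false (by simp [guard_eval, hend η h]), h⟩
  | succ m ih =>
    obtain ⟨hb, hz, c, η₁, h₁, hI⟩ := hstep m η h
    obtain ⟨d, η₂, h₂, hI⟩ := ih η₁ hI
    exact ⟨_, η₂, .loop_true (by simp [guard_eval, hb, hz]) (.seq (.coin η) h₁) h₂, hI⟩

/-- `P` applies `f` to the variable `k`, without any effect on the variables below `k` other than
the variable `1`, provided that the flag is not raised. -/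
structure Computes (k : ℕ) (P : Prog) (f : ℕ → ℕ) : Prop where
  instr : Instr P
  exec : ∀ (η : Val) (n : ℕ), η 0 = 0 → η k = n →
    Exec P η fun η' => η' k = f n ∧ ∀ v : ℕ, v < k → v ≠ 1 → η' v = η v

theorem Computes.comp {k : ℕ} {P Q : Prog} {f g : ℕ → ℕ} (hk : 2 ≤ k) (hP : Computes k P f)
    (hQ : Computes k Q g) : Computes k (.seq Q P) fun n => f (g n) where
  instr := .seq hQ.instr hP.instr
  exec η n hz hn := .seq <| (hQ.exec η n hz hn).mono fun η₁ ⟨h₁, f₁⟩ =>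
    (hP.exec η₁ _ ((f₁ 0 (by omega) (by omega)).trans hz) h₁).mono fun η₂ ⟨h₂, f₂⟩ =>
      ⟨h₂, fun v hv hv' => (f₂ v hv hv').trans (f₁ v hv hv')⟩

theorem toNNRat_sub_natCast (a b : ℕ) : ((a : ℚ) - b).toNNRat = ((a - b : ℕ) : ℚ≥0) := by
  rcases le_total b a with h | h
  · rw [← Nat.cast_sub h]; simp
  · rw [Nat.sub_eq_zero_of_le h, Rat.toNNRat_eq_zero.2 (by simpa using h)]; simp

/-- Stores the pair of the variables `k` and `k + 1` in the variable `k`. -/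
def pairProg (k : ℕ) : Prog :=
  .seq (.assign (k + 2) (.sub (.var (k + 1)) (.var k))) <|
  .seq (.assign (k + 2) (.sub (.const 1) (.var (k + 2)))) <|
  .assign k (.add
    (.mul (.var (k + 2)) (.add (.add (.mul (.var k) (.var k)) (.var k)) (.var (k + 1))))
    (.mul (.sub (.const 1) (.var (k + 2))) (.add (.mul (.var (k + 1)) (.var (k + 1))) (.var k))))

theorem pairProg_instr {k : ℕ} (hk : 2 ≤ k) : Instr (pairProg k) :=
  .seq (.assign _ (by omega)) (.seq (.assign _ (by omega)) (.assign _ hk))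

theorem pairProg_exec (k : ℕ) (η : Val) (a b : ℕ) (ha : η k = a) (hb : η (k + 1) = b) :
    Exec (pairProg k) η fun η' => η' k = (Nat.pair a b : ℕ) ∧ ∀ v : ℕ, v < k → η' v = η v := by
  refine .seq <| .assign (b - a) ?_ fun η₁ h₁ f₁ => .seq <| .assign (1 - (b - a)) ?_
    fun η₂ h₂ f₂ => .assign (Nat.pair a b) ?_ fun η₃ h₃ f₃ => ⟨h₃, by grind⟩
  · simpa [AExpr.eval, ha, hb] using toNNRat_sub_natCast b a
  · simpa only [AExpr.eval, h₁, NNRat.cast_natCast, Nat.cast_one, NNRat.cast_one] using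
      toNNRat_sub_natCast 1 (b - a)
  · have e₁ : η₂ k = a := by grind
    have e₂ : η₂ (k + 1) = b := by grind
    simp only [AExpr.eval, h₂, e₁, e₂]
    unfold Nat.pair
    split_ifs with h
    · rw [show 1 - (b - a) = 0 by omega]
      apply NNRat.coe_injective
      rw [Rat.coe_toNNRat _ (by simp; positivity)]
      simp
    · rw [show 1 - (b - a) = 1 by omega]
      apply NNRat.coe_injective
      rw [Rat.coe_toNNRat _ (by simp; positivity)]
      simp

/-- Stores the integer square root `s` of the variable `k` in the variable `k + 1`, the difference
`d` of the variable `k` and `s * s` in the variable `k + 2`, and the truth value of `s ≤ d` in the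
variable `k + 3`. -/
def sqrtProg (k : ℕ) : Prog :=
  .seq (.assign (k + 1) (.const 0)) <|
  .seq (iloop (.le (.mul (.add (.var (k + 1)) (.const 1)) (.add (.var (k + 1)) (.const 1))) (.var k))
    (.assign (k + 1) (.add (.var (k + 1)) (.const 1)))) <|
  .seq (.assign (k + 2) (.sub (.var k) (.mul (.var (k + 1)) (.var (k + 1))))) <|
  .seq (.assign (k + 3) (.sub (.var (k + 1)) (.var (k + 2)))) <|
  .assign (k + 3) (.sub (.const 1) (.var (k + 3)))

theorem sqrtProg_instr {k : ℕ} (hk : 2 ≤ k) : Instr (sqrtProg k) :=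
  .seq (.assign _ (by omega)) (.seq (.iloop _ (.assign _ (by omega)))
    (.seq (.assign _ (by omega)) (.seq (.assign _ (by omega)) (.assign _ (by omega)))))

theorem sqrtProg_exec {k : ℕ} (hk : 2 ≤ k) (η : Val) (n : ℕ) (hz : η 0 = 0) (hn : η k = n) :
    Exec (sqrtProg k) η fun η' => η' (k + 1) = (n.sqrt : ℕ) ∧
      η' (k + 2) = (n - n.sqrt * n.sqrt : ℕ) ∧
      η' (k + 3) = (1 - (n.sqrt - (n - n.sqrt * n.sqrt)) : ℕ) ∧
      ∀ v : ℕ, v < k → v ≠ 1 → η' v = η v := by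
  refine .seq <| .assign 0 (by simp [AExpr.eval]) fun η₁ h₁ f₁ => .seq ?_
  refine (Exec.iloop (fun m ζ => ∃ s : ℕ, s + m = n.sqrt ∧ ζ (k + 1) = s ∧ ζ k = n ∧
    ∀ v : ℕ, v < k → v ≠ 1 → ζ v = η v) ?_ ?_ n.sqrt η₁ ⟨0, by simp, by simpa using h₁,
      by grind, by grind⟩).mono ?_
  · rintro m ζ ⟨s, hs, hζ₁, hζ, hf⟩
    refine ⟨?_, by grind, .assign (s + 1) ?_ fun ζ' h f => ⟨s + 1, by omega, h, ?_, ?_⟩⟩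
    · simp only [BExpr.eval, AExpr.eval, hζ₁, hζ, decide_eq_true_eq]
      have : (s + 1) * (s + 1) ≤ n := Nat.le_sqrt.1 (by omega)
      simp
      exact_mod_cast this
    · rw [AExpr.eval, AExpr.eval, AExpr.eval, dbl_of_ne _ (by omega), hζ₁]
      apply NNRat.coe_injective
      rw [Rat.coe_toNNRat _ (by positivity)]
      simp
    · rw [f k (by omega), dbl_of_ne _ (by omega), hζ]
    · intro v hv hv'
      rw [f v (by omega), dbl_of_ne _ hv', hf v hv hv']
  · rintro ζ ⟨s, hs, hζ₁, hζ, hf⟩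
    simp only [BExpr.eval, AExpr.eval, hζ₁, hζ, decide_eq_false_iff_not]
    have : n < (s + 1) * (s + 1) := Nat.sqrt_lt.1 (by omega)
    simp
    exact_mod_cast this
  · rintro ζ ⟨s, hs, hζ₁, hζ, hf⟩
    obtain rfl : s = n.sqrt := by omega
    refine .seq <| .assign (n - n.sqrt * n.sqrt) ?_ fun η₂ h₂ f₂ => .seq <|
      .assign (n.sqrt - (n - n.sqrt * n.sqrt)) ?_ fun η₃ h₃ f₃ => .assign _ ?_
      fun η₄ h₄ f₄ => ⟨?_, ?_, h₄, ?_⟩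
    · simpa [AExpr.eval, hζ, hζ₁] using toNNRat_sub_natCast n (n.sqrt * n.sqrt)
    · have : η₂ (k + 1) = (n.sqrt : ℕ) := by grind
      simpa only [AExpr.eval, h₂, this, NNRat.cast_natCast] using
        toNNRat_sub_natCast n.sqrt (n - n.sqrt * n.sqrt)
    · simpa only [AExpr.eval, h₃, NNRat.cast_natCast, Nat.cast_one, NNRat.cast_one] using
        toNNRat_sub_natCast 1 (n.sqrt - (n - n.sqrt * n.sqrt))
    · grind
    · grind
    · grind

/-- The first component of the unpairing of the variable `k`. -/
def leftProg (k : ℕ) : Prog :=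
  .seq (sqrtProg k) <| .assign k <| .add (.mul (.var (k + 3)) (.var (k + 1)))
    (.mul (.sub (.const 1) (.var (k + 3))) (.var (k + 2)))

/-- The second component of the unpairing of the variable `k`. -/
def rightProg (k : ℕ) : Prog :=
  .seq (sqrtProg k) <| .assign k <| .add
    (.mul (.var (k + 3)) (.sub (.var (k + 2)) (.var (k + 1))))
    (.mul (.sub (.const 1) (.var (k + 3))) (.var (k + 1)))

theorem leftProg_computes {k : ℕ} (hk : 2 ≤ k) :
    Computes k (leftProg k) fun n => n.unpair.1 where
  instr := .seq (sqrtProg_instr hk) (.assign _ hk)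
  exec η n hz hn := by
    refine .seq <| (sqrtProg_exec hk η n hz hn).mono fun η₁ ⟨h₁, h₂, h₃, hf⟩ =>
      .assign _ ?_ fun η₂ e f => ⟨e, by grind⟩
    simp only [AExpr.eval, h₁, h₂, h₃, Nat.unpair]
    split_ifs with h
    · rw [show 1 - (n.sqrt - (n - n.sqrt * n.sqrt)) = 0 by omega]
      simp
    · rw [show 1 - (n.sqrt - (n - n.sqrt * n.sqrt)) = 1 by omega]
      simp

theorem rightProg_computes {k : ℕ} (hk : 2 ≤ k) :
    Computes k (rightProg k) fun n => n.unpair.2 where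
  instr := .seq (sqrtProg_instr hk) (.assign _ hk)
  exec η n hz hn := by
    refine .seq <| (sqrtProg_exec hk η n hz hn).mono fun η₁ ⟨h₁, h₂, h₃, hf⟩ =>
      .assign _ ?_ fun η₂ e f => ⟨e, by grind⟩
    simp only [AExpr.eval, h₁, h₂, h₃, Nat.unpair]
    split_ifs with h
    · rw [show 1 - (n.sqrt - (n - n.sqrt * n.sqrt)) = 0 by omega]
      simp
    · rw [show 1 - (n.sqrt - (n - n.sqrt * n.sqrt)) = 1 by omega]
      simpa only [NNRat.cast_natCast, Nat.cast_one, NNRat.cast_one, one_mul, sub_self, zero_mul,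
        add_zero] using toNNRat_sub_natCast (n - n.sqrt * n.sqrt) n.sqrt

theorem zero_computes {k : ℕ} (hk : 2 ≤ k) : Computes k (.assign k (.const 0)) fun _ => 0 where
  instr := .assign _ hk
  exec η n hz hn := .assign 0 (by simp [AExpr.eval]) fun η₁ e f => ⟨e, by grind⟩

theorem succ_computes {k : ℕ} (hk : 2 ≤ k) :
    Computes k (.assign k (.add (.var k) (.const 1))) Nat.succ where
  instr := .assign _ hk
  exec η n hz hn := by
    refine .assign _ ?_ fun η₁ e f => ⟨e, by grind⟩
    rw [AExpr.eval, AExpr.eval, AExpr.eval, hn]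
    apply NNRat.coe_injective
    rw [Rat.coe_toNNRat _ (by positivity)]
    simp

theorem Exec.copy {u v : ℕ} {η : Val} {R : Val → Prop} (m : ℕ) (h : η u = m)
    (hR : ∀ η' : Val, η' v = m → (∀ u : ℕ, u ≠ v → η' u = η u) → R η') :
    Exec (.assign v (.var u)) η R :=
  .assign m (by simp [AExpr.eval, h]) hR

theorem Computes.pair {k : ℕ} (hk : 2 ≤ k) {P Q : Prog} {f g : ℕ → ℕ}
    (hP : Computes (k + 1) P f) (hQ : Computes (k + 2) Q g) :
    ∃ S, Computes k S fun n => Nat.pair (f n) (g n) := by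
  refine ⟨.seq (.assign (k + 1) (.var k)) <| .seq P <| .seq (.assign (k + 2) (.var k)) <|
    .seq Q <| .seq (.assign k (.var (k + 1))) <| .seq (.assign (k + 1) (.var (k + 2))) (pairProg k),
    .seq (.assign _ (by omega)) <| .seq hP.instr <| .seq (.assign _ (by omega)) <|
    .seq hQ.instr <| .seq (.assign _ (by omega)) <| .seq (.assign _ (by omega)) (pairProg_instr hk),
    fun η n hz hn => ?_⟩
  refine .seq <| .copy n hn fun η₁ h₁ f₁ => .seq <| (hP.exec η₁ n (by grind) h₁).mono ?_
  rintro η₂ ⟨h₂, f₂⟩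
  refine .seq <| .copy n (by grind) fun η₃ h₃ f₃ => .seq <| (hQ.exec η₃ n (by grind) h₃).mono ?_
  rintro η₄ ⟨h₄, f₄⟩
  refine .seq <| .copy (f n) (by grind) fun η₅ h₅ f₅ => .seq <| .copy (g n) (by grind)
    fun η₆ h₆ f₆ => (pairProg_exec k η₆ (f n) (g n) (by grind) h₆).mono ?_
  rintro η₇ ⟨h₇, f₇⟩
  exact ⟨h₇, by grind⟩

theorem Computes.prec {k : ℕ} (hk : 2 ≤ k) {P Q : Prog} {f g : ℕ → ℕ}
    (hP : Computes (k + 4) P f) (hQ : Computes (k + 5) Q g) :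
    ∃ S, Computes k S (Nat.unpaired fun z n =>
      Nat.rec (f z) (fun y IH => g (Nat.pair z (Nat.pair y IH))) n) := by
  refine ⟨.seq (.assign (k + 1) (.var k)) <| .seq (leftProg (k + 1)) <|
    .seq (.assign (k + 2) (.var k)) <| .seq (rightProg (k + 2)) <|
    .seq (.assign (k + 4) (.var (k + 1))) <| .seq P <| .seq (.assign (k + 3) (.const 0)) <|
    .seq (iloop (.le (.add (.var (k + 3)) (.const 1)) (.var (k + 2))) <|
      .seq (.assign (k + 5) (.var (k + 1))) <| .seq (.assign (k + 6) (.var (k + 3))) <|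
      .seq (.assign (k + 7) (.var (k + 4))) <| .seq (pairProg (k + 6)) <|
      .seq (pairProg (k + 5)) <| .seq Q <| .seq (.assign (k + 4) (.var (k + 5)))
        (.assign (k + 3) (.add (.var (k + 3)) (.const 1)))) <|
    .assign k (.var (k + 4)),
    .seq (.assign _ (by omega)) <| .seq (leftProg_computes (by omega)).instr <|
    .seq (.assign _ (by omega)) <| .seq (rightProg_computes (by omega)).instr <|
    .seq (.assign _ (by omega)) <| .seq hP.instr <| .seq (.assign _ (by omega)) <|
    .seq (.iloop _ <|
      .seq (.assign _ (by omega)) <| .seq (.assign _ (by omega)) <|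
      .seq (.assign _ (by omega)) <| .seq (pairProg_instr (by omega)) <|
      .seq (pairProg_instr (by omega)) <| .seq hQ.instr <| .seq (.assign _ (by omega))
        (.assign _ (by omega))) <|
    .assign _ hk, fun η n hz hn => ?_⟩
  set z := n.unpair.1 with hz'
  set m := n.unpair.2 with hm'
  set r : ℕ → ℕ := fun i => Nat.rec (f z) (fun y IH => g (Nat.pair z (Nat.pair y IH))) i with hr
  refine .seq <| .copy n hn fun η₁ h₁ f₁ => .seq <|
    ((leftProg_computes (k := k + 1) (by omega)).exec η₁ n (by grind) h₁).mono ?_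
  rintro η₂ ⟨h₂, f₂⟩
  refine .seq <| .copy n (by grind) fun η₃ h₃ f₃ => .seq <|
    ((rightProg_computes (k := k + 2) (by omega)).exec η₃ n (by grind) h₃).mono ?_
  rintro η₄ ⟨h₄, f₄⟩
  refine .seq <| .copy z (by grind) fun η₅ h₅ f₅ => .seq <|
    (hP.exec η₅ z (by grind) h₅).mono ?_
  rintro η₆ ⟨h₆, f₆⟩
  refine .seq <| .assign 0 (by simp [AExpr.eval]) fun η₇ h₇ f₇ => .seq ?_
  refine (Exec.iloop (fun i ζ => ∃ y : ℕ, y + i = m ∧ ζ (k + 1) = z ∧ ζ (k + 2) = m ∧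
    ζ (k + 3) = y ∧ ζ (k + 4) = r y ∧ ∀ v : ℕ, v < k → v ≠ 1 → ζ v = η v) ?_ ?_ m η₇
      ⟨0, by simp, by grind, by grind, by simpa using h₇, (f₇ _ (by omega)).trans h₆, by grind⟩).mono ?_
  · rintro i ζ ⟨y, hy, hζ₁, hζ₂, hζ₃, hζ₄, hf⟩
    refine ⟨?_, by grind, ?_⟩
    · simp only [BExpr.eval, AExpr.eval, hζ₂, hζ₃, decide_eq_true_eq]
      have : y + 1 ≤ m := by omega
      simp
      exact_mod_cast this
    have hd : ∀ v : ℕ, v ≠ 1 → dbl ζ v = ζ v := fun v hv => dbl_of_ne ζ hv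
    refine .seq <| .copy z (by grind) fun ζ₁ e₁ g₁ => .seq <| .copy y (by grind)
      fun ζ₂ e₂ g₂ => .seq <| .copy (r y) (by grind) fun ζ₃ e₃ g₃ => .seq <|
      (pairProg_exec (k + 6) ζ₃ y (r y) (by grind) e₃).mono ?_
    rintro ζ₄ ⟨e₄, g₄⟩
    refine .seq <| (pairProg_exec (k + 5) ζ₄ z (Nat.pair y (r y)) (by grind) e₄).mono ?_
    rintro ζ₅ ⟨e₅, g₅⟩
    refine .seq <| (hQ.exec ζ₅ _ (by grind) e₅).mono ?_
    rintro ζ₆ ⟨e₆, g₆⟩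
    refine .seq <| .copy _ e₆ fun ζ₇ e₇ g₇ => .assign (y + 1) ?_ fun ζ₈ e₈ g₈ =>
      ⟨y + 1, by omega, by grind, by grind, e₈, ?_, by grind⟩
    · have : ζ₇ (k + 3) = y := by grind
      rw [AExpr.eval, AExpr.eval, AExpr.eval, this]
      apply NNRat.coe_injective
      rw [Rat.coe_toNNRat _ (by positivity)]
      simp
    · rw [g₈ _ (by omega), e₇]
  · rintro ζ ⟨y, hy, hζ₁, hζ₂, hζ₃, hζ₄, hf⟩
    simp only [BExpr.eval, AExpr.eval, hζ₂, hζ₃, decide_eq_false_iff_not]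
    have : m < y + 1 := by omega
    simp
    exact_mod_cast this
  · rintro ζ ⟨y, hy, hζ₁, hζ₂, hζ₃, hζ₄, hf⟩
    obtain rfl : y = m := by omega
    exact .copy _ hζ₄ fun ζ₁ e₁ g₁ => ⟨e₁, by grind⟩

theorem exists_computes {f : ℕ → ℕ} (hf : Nat.Primrec f) (k : ℕ) (hk : 2 ≤ k) :
    ∃ P, Computes k P f := by
  induction hf generalizing k with
  | zero => exact ⟨_, zero_computes hk⟩
  | succ => exact ⟨_, succ_computes hk⟩
  | left => exact ⟨_, leftProg_computes hk⟩
  | right => exact ⟨_, rightProg_computes hk⟩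
  | pair _ _ ih₁ ih₂ =>
    obtain ⟨P, hP⟩ := ih₁ (k + 1) (by omega)
    obtain ⟨Q, hQ⟩ := ih₂ (k + 2) (by omega)
    exact hP.pair hk hQ
  | comp _ _ ih₁ ih₂ =>
    obtain ⟨P, hP⟩ := ih₁ k hk
    obtain ⟨Q, hQ⟩ := ih₂ k hk
    exact ⟨_, hP.comp hk hQ⟩
  | prec _ _ ih₁ ih₂ =>
    obtain ⟨P, hP⟩ := ih₁ (k + 4) (by omega)
    obtain ⟨Q, hQ⟩ := ih₂ (k + 5) (by omega)
    exact hP.prec hk hQ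

/-! ### A program that wastes time whenever a function has a value other than 0 -/

/-- Counts the variable `4` down to `0`. -/
def waste : Prog :=
  .loop (.le (.const 1) (.var 4)) (.assign 4 (.sub (.var 4) (.const 1)))

theorem En_waste (n m : ℕ) (l : List Prog) (η : Val) (h : η 4 = m) :
    En (n + (3 * m + 1)) (plug waste.toCmd l) η =
      3 * m + 1 + En n (plug .term l) (assignVal η 4 0) := by
  induction m generalizing η with
  | zero =>
    have : assignVal η 4 0 = η := by
      ext v
      by_cases hv : v = 4
      · subst hv; simp [assignVal_apply, h]
      · simp [assignVal_apply, hv]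
    rw [this, waste, Nat.mul_zero, Nat.zero_add, En_plug_loop_false]
    · simp
    · simp [BExpr.eval, AExpr.eval, h]
  | succ m ih =>
    rw [waste, show n + (3 * (m + 1) + 1) = n + (3 * m + 1) + 1 + 1 + 1 by ring,
      En_plug_loop_true, En_plug_assign, En_plug_term_cons, ← waste, ih]
    · have : ∀ q, assignVal (assignVal η 4 q) 4 0 = assignVal η 4 0 := by
        intro q
        ext v
        by_cases hv : v = 4
        · subst hv; simp [assignVal_apply]
        · simp [assignVal_apply, hv]
      rw [this]
      push_cast
      ring
    · rw [assignVal_apply, if_pos rfl, AExpr.eval, AExpr.eval, AExpr.eval, h]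
      simp
    · simp [BExpr.eval, AExpr.eval, h]

/-- Wastes time if the flag is not raised, and increments the counter `3`. -/
def tailProg : Prog :=
  .seq (.assign 4 (.mul (.mul (.var 5) (.var 1)) (.sub (.const 1) (.var 0)))) <|
  .seq waste (.assign 3 (.add (.var 3) (.const 1)))

theorem En_tailProg (m : ℕ) (η : Val) (h : ((η 5 : ℚ) * η 1 * (1 - η 0)).toNNRat = m) :
    ∃ η' : Val, η' 3 = η 3 + 1 ∧ (∀ v : ℕ, v ≠ 3 → v ≠ 4 → η' v = η v) ∧
      ∀ n l, En (n + (3 * m + 5)) (plug tailProg.toCmd l) η =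
        3 * m + 5 + En n (plug .term l) η' := by
  set η₁ := assignVal η 4
    ((AExpr.mul (.mul (.var 5) (.var 1)) (.sub (.const 1) (.var 0))).eval η) with hη₁
  set η₂ := assignVal η₁ 4 0 with hη₂
  refine ⟨assignVal η₂ 3 ((AExpr.add (.var 3) (.const 1)).eval η₂), ?_, ?_, fun n l => ?_⟩
  · rw [assignVal_apply, if_pos rfl, hη₂, hη₁]
    simp only [AExpr.eval, assignVal_apply]
    apply NNRat.coe_injective
    rw [Rat.coe_toNNRat _ (by positivity)]
    simp
  · intro v h₃ h₄
    rw [hη₂, hη₁]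
    simp only [assignVal_apply, if_neg h₃, if_neg h₄]
  · rw [tailProg, plug_seq, show n + (3 * m + 5) = n + 1 + 1 + (3 * m + 1) + 1 + 1 by ring,
      En_plug_assign, En_plug_term_cons, plug_seq, En_waste (m := m), En_plug_term_cons,
      En_plug_assign]
    · ring
    · rw [assignVal_apply, if_pos rfl]
      simpa [AExpr.eval] using h

/-- Computes the pair of the variables `2` and `3` in the variable `5` and applies `P` to it. -/
def evalProg (P : Prog) : Prog :=
  .seq (.assign 5 (.var 2)) <| .seq (.assign 6 (.var 3)) <| .seq (pairProg 5) P

/-- The body of `mainLoop`. -/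
def mainBody (P : Prog) : Prog := .seq (.seq coin (evalProg P)) tailProg

/-- For `s = 0, 1, 2, …`, this program applies `P` to `⟨x, s⟩`. If `2 ^ c` is the reciprocal of
the probability that the flag has not been raised so far, and if `e` is the result of `P`, then it
wastes time proportional to `e * 2 ^ c`. -/
def mainLoop (P : Prog) : Prog := .loop (.eq (.var 0) (.const 0)) (mainBody P)

/-- The states at the beginning of the iteration `s` of `mainLoop` if the flag is not raised. -/
structure LoopInv (x s c : ℕ) (η : Val) : Prop where
  flag : η 0 = 0
  weight : η 1 = 2 ^ c
  input : η 2 = x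
  counter : η 3 = s

theorem evalProg_exec {P : Prog} {f : ℕ → ℕ} (hP : Computes 5 P f) {x s c : ℕ} {η : Val}
    (h : LoopInv x s c η) :
    ∃ d η', 1 ≤ d ∧ Big (.seq coin (evalProg P)) η d η' ∧ LoopInv x s (c + d) η' ∧
      η' 5 = f (Nat.pair x s) := by
  have hi : Instr (evalProg P) := .seq (.assign _ (by omega)) <| .seq (.assign _ (by omega)) <|
    .seq (pairProg_instr (by omega)) hP.instr
  obtain ⟨h₀, h₁, h₂, h₃⟩ := h
  have hd : ∀ v : ℕ, v ≠ 1 → dbl η v = η v := fun v hv => dbl_of_ne η hv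
  have : Exec (evalProg P) (dbl η) fun η' => η' 5 = f (Nat.pair x s) ∧ η' 2 = x ∧ η' 3 = s := by
    refine .seq <| .copy x (by grind) fun η₁ e₁ f₁ => .seq <| .copy s (by grind) fun η₂ e₂ f₂ =>
      .seq <| (pairProg_exec 5 η₂ x s (by grind) e₂).mono ?_
    rintro η₃ ⟨e₃, f₃⟩
    refine (hP.exec η₃ _ (by grind) e₃).mono ?_
    rintro η₄ ⟨e₄, f₄⟩
    exact ⟨e₄, by grind, by grind⟩
  obtain ⟨d, η', hr, e₅, e₂, e₃⟩ := this
  obtain ⟨e₀, e₁⟩ := hi.frame hr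
  refine ⟨1 + d, η', by omega, .seq (.coin η) hr, ⟨?_, ?_, e₂, e₃⟩, e₅⟩
  · rw [e₀, dbl_of_ne _ (by decide), h₀]
  · rw [e₁, dbl_one, h₁]
    ring

theorem Bounded.evalProg {P : Prog} {f : ℕ → ℕ} (hP : Computes 5 P f) :
    ∃ K, Bounded (.seq PGCL.coin (evalProg P)) K := by
  have hi : Instr (PGCL.evalProg P) := .seq (.assign _ (by omega)) <|
    .seq (.assign _ (by omega)) <| .seq (pairProg_instr (by omega)) hP.instr
  obtain ⟨K, hK⟩ := hi.bounded
  refine ⟨_, Bounded.coin.seq hK ?_⟩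
  intro η c η' hr
  obtain ⟨rfl, rfl⟩ := hr.of_coin
  exact dbl_of_ne _ (by decide)

theorem mainLoop_step {P : Prog} {f : ℕ → ℕ} (hP : Computes 5 P f) :
    ∃ K : ℚ, 0 ≤ K ∧ ∀ x s c η, LoopInv x s c η → ∃ d η', 1 ≤ d ∧ LoopInv x (s + 1) (c + d) η' ∧
      (∀ n, En n (mainLoop P).toCmd η ≤ K + (1 / 2) ^ d *
        (3 * (f (Nat.pair x s) * 2 ^ (c + d) : ℕ) + En n (mainLoop P).toCmd η')) ∧
      ∃ t, ∀ n, (1 / 2) ^ d * ((f (Nat.pair x s) * 2 ^ (c + d) : ℕ) + En n (mainLoop P).toCmd η') ≤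
        En (n + t) (mainLoop P).toCmd η := by
  obtain ⟨K, hK⟩ := Bounded.evalProg hP
  refine ⟨1 + K * 9 + 7, by linarith [hK.one_le], fun x s c η hη => ?_⟩
  obtain ⟨d, η₁, hd, hr, hη₁, h₅⟩ := evalProg_exec hP hη
  set m : ℕ := f (Nat.pair x s) * 2 ^ (c + d) with hm
  have hb : (BExpr.eq (.var 0) (.const 0)).eval η = true := by
    simp [BExpr.eval, AExpr.eval, hη.flag]
  obtain ⟨η', e₃, e, ht⟩ := En_tailProg m η₁ (by
    rw [h₅, hη₁.weight, hη₁.flag]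
    apply NNRat.coe_injective
    rw [Rat.coe_toNNRat _ (by simp)]
    simp [hm])
  refine ⟨d, η', hd, ⟨?_, ?_, ?_, ?_⟩, fun n => ?_, ?_⟩
  · rw [e 0 (by decide) (by decide), hη₁.flag]
  · rw [e 1 (by decide) (by decide), hη₁.weight]
  · rw [e 2 (by decide) (by decide), hη₁.input]
  · rw [e₃, hη₁.counter]
    push_cast
    rfl
  · have h₁ := En_plug_loop_true_le n _ (mainBody P) [] η hb
    rw [← mainLoop, mainBody, plug_seq] at h₁
    have h₂ := hK.upper n [tailProg, mainLoop P] 8 (by norm_num) (fun ζ hζ => by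
      obtain ⟨ζ', -, e, ht⟩ := En_tailProg 0 ζ (by simp [hζ])
      have h₁ := ht n [mainLoop P]
      have h₂ := En_plug_term_cons_le n (mainLoop P) [] ζ'
      have h₃ := En_plug_loop_false_le n (.eq (.var 0) (.const 0)) (mainBody P) [] ζ' (by
        simp [BExpr.eval, AExpr.eval, e 0 (by decide) (by decide), hζ])
      have h₄ := En_plug_term_cons_le n tailProg [mainLoop P] ζ
      have h₅ := En_mono (Nat.le_add_right n (3 * 0 + 5)) (plug tailProg.toCmd [mainLoop P]) ζ
      rw [plug_nil] at h₂
      simp only [plug_nil, En_term] at h₃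
      rw [← mainLoop] at h₃
      push_cast at h₁
      linarith) η η₁ d hη.flag hr
    have h₃ := En_plug_term_cons_le n tailProg [mainLoop P] η₁
    have h₄ := En_mono (Nat.le_add_right n (3 * m + 5)) (plug tailProg.toCmd [mainLoop P]) η₁
    rw [ht n [mainLoop P]] at h₄
    have h₅ := En_plug_term_cons_le n (mainLoop P) [] η'
    have hx₀ : (0 : ℚ) ≤ (1 / 2) ^ d := by positivity
    have hx₁ : ((1 : ℚ) / 2) ^ d ≤ 1 := pow_le_one₀ (by norm_num) (by norm_num)
    have h₆ : En n (plug .term [tailProg, mainLoop P]) η₁ ≤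
        7 + (3 * m + En n (mainLoop P).toCmd η') := by
      rw [plug_nil] at h₅
      linarith
    have h₇ := mul_le_mul_of_nonneg_left h₆ hx₀
    rw [plug_nil] at h₁
    linarith
  · obtain ⟨t, hl⟩ := hr.lower
    refine ⟨1 + (3 * m + 5) + 1 + t + 1, fun n => ?_⟩
    have h₁ := hl (n + 1 + (3 * m + 5) + 1) [tailProg, mainLoop P]
    rw [En_plug_term_cons, ht, En_plug_term_cons, plug_nil] at h₁
    have h₂ := En_plug_loop_true (n + 1 + (3 * m + 5) + 1 + t) _ (mainBody P) [] η hb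
    rw [← mainLoop, mainBody, plug_seq, plug_nil] at h₂
    rw [show n + (1 + (3 * m + 5) + 1 + t + 1) = n + 1 + (3 * m + 5) + 1 + t + 1 by ring, h₂]
    refine le_trans ?_ (h₁.trans (by linarith))
    refine mul_le_mul_of_nonneg_left ?_ (by positivity)
    have : (0 : ℚ) ≤ m := by positivity
    linarith

theorem mainLoop_lower {P : Prog} {f : ℕ → ℕ} (hP : Computes 5 P f) (N x s c : ℕ) (η : Val)
    (hη : LoopInv x s c η) :
    ∃ t, 2 ^ c * ∑ i ∈ Finset.range N, (f (Nat.pair x (s + i)) : ℚ) ≤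
      En t (mainLoop P).toCmd η := by
  obtain ⟨K, -, hK⟩ := mainLoop_step hP
  induction N generalizing s c η with
  | zero => exact ⟨0, by simp [En_nonneg]⟩
  | succ N ih =>
    obtain ⟨d, η', -, hη', -, t, ht⟩ := hK x s c η hη
    obtain ⟨t', ht'⟩ := ih (s + 1) (c + d) η' hη'
    refine ⟨t' + t, le_trans ?_ (ht t')⟩
    rw [Finset.sum_range_succ']
    rw [Finset.sum_congr rfl fun i _ => by rw [show s + (i + 1) = s + 1 + i by ring], add_zero]
    have h : (1 / 2 : ℚ) ^ d * 2 ^ d = 1 := by rw [← mul_pow]; norm_num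
    have h₁ := mul_le_mul_of_nonneg_left ht' (show (0 : ℚ) ≤ (1 / 2) ^ d by positivity)
    push_cast
    calc _ = ((1 / 2 : ℚ) ^ d * 2 ^ d) * 2 ^ c *
          (∑ i ∈ Finset.range N, (f (Nat.pair x (s + 1 + i)) : ℚ) + f (Nat.pair x s)) := by
          rw [h, one_mul]
      _ = (1 / 2) ^ d * (f (Nat.pair x s) * 2 ^ (c + d)) + (1 / 2) ^ d * (2 ^ (c + d) *
          ∑ i ∈ Finset.range N, (f (Nat.pair x (s + 1 + i)) : ℚ)) := by ring
      _ ≤ _ := by rw [mul_add]; gcongr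

theorem mainLoop_upper {P : Prog} {f : ℕ → ℕ} (hP : Computes 5 P f) (x s₀ : ℕ)
    (hs : ∀ s, s₀ ≤ s → f (Nat.pair x s) = 0) (i s c : ℕ) (hi : s + i = s₀) (η : Val)
    (hη : LoopInv x s c η) : ∃ M, ∀ n, En n (mainLoop P).toCmd η ≤ M := by
  obtain ⟨K, hK₀, hK⟩ := mainLoop_step hP
  have half_pow : ∀ d : ℕ, 1 ≤ d → ((1 : ℚ) / 2) ^ d ≤ 1 / 2 := fun d hd => by
    simpa only [pow_one] using
      pow_le_pow_of_le_one (by norm_num : (0 : ℚ) ≤ 1 / 2) (by norm_num) hd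
  induction i generalizing s c η with
  | zero =>
    refine ⟨2 * K + 1, fun n => ?_⟩
    have key : ∀ j s c η, s₀ ≤ s → LoopInv x s c η →
        En n (mainLoop P).toCmd η ≤ 2 * K + n / 2 ^ j := by
      intro j
      induction j with
      | zero =>
        intro s c η _ _
        have := En_le n (mainLoop P).toCmd η
        simp only [pow_zero, div_one]
        linarith
      | succ j ih =>
        intro s c η hs' hη
        obtain ⟨d, η', hd, hη', hu, -⟩ := hK x s c η hη
        have h₁ := ih (s + 1) (c + d) η' (by omega) hη'
        have h₂ := hu n
        rw [hs s hs', Nat.zero_mul, Nat.cast_zero, mul_zero, zero_add] at h₂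
        have h₃ := mul_le_mul (half_pow d hd) h₁ (En_nonneg _ _ _) (by norm_num)
        rw [pow_succ]
        have h₄ : (n : ℚ) / (2 ^ j * 2) = 1 / 2 * (n / 2 ^ j) := by field_simp
        rw [h₄]
        linarith
    have h₁ := key n s c η (by omega) hη
    have h₂ : (n : ℚ) / 2 ^ n ≤ 1 := by
      rw [div_le_one (by positivity)]
      exact_mod_cast n.lt_two_pow_self.le
    linarith
  | succ i ih =>
    obtain ⟨d, η', hd, hη', hu, -⟩ := hK x s c η hη
    obtain ⟨M, hM⟩ := ih (s + 1) (c + d) (by omega) η' hη'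
    refine ⟨K + 1 * (3 * (f (Nat.pair x s) * 2 ^ (c + d) : ℕ) + M), fun n => (hu n).trans ?_⟩
    have := En_nonneg n (mainLoop P).toCmd η'
    gcongr
    · exact (half_pow d hd).trans (by norm_num)
    · exact hM n

/-- Initialises the variables of `mainLoop` and runs it. -/
def mainProg (P : Prog) (x : ℕ) : Prog :=
  .seq (.assign 2 (.const x)) (.seq (.assign 1 (.const 1)) (mainLoop P))

theorem past_mainProg_iff {P : Prog} {f : ℕ → ℕ} (hP : Computes 5 P f) (x : ℕ) :
    PAST (mainProg P x, 0) ↔ {s | f (Nat.pair x s) ≠ 0}.Finite := by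
  rw [past_iff]
  set η : Val := assignVal (assignVal 0 2 ((AExpr.const (x : ℚ≥0)).eval 0)) 1
    ((AExpr.const 1).eval (assignVal 0 2 ((AExpr.const (x : ℚ≥0)).eval 0))) with hη'
  have hη : LoopInv x 0 0 η := by
    constructor <;> simp [hη', assignVal_apply, AExpr.eval]
  have hE : ∀ n, En (n + 4) (mainProg P x).toCmd 0 = 4 + En n (mainLoop P).toCmd η := by
    intro n
    rw [show n + 4 = n + 1 + 1 + 1 + 1 by ring, mainProg, ← plug_nil (Prog.toCmd _), plug_seq,
      En_plug_assign, En_plug_term_cons, plug_seq, En_plug_assign, En_plug_term_cons, plug_nil]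
    ring
  constructor
  · rintro ⟨C, hC⟩
    by_contra hinf
    obtain ⟨F, hF, hcard⟩ := Set.Infinite.exists_subset_card_eq hinf (C + 1)
    obtain ⟨N, hN⟩ := F.exists_nat_subset_range
    obtain ⟨t, ht⟩ := mainLoop_lower hP N x 0 0 η hη
    have h₁ : ((C + 1 : ℕ) : ℚ) ≤ ∑ i ∈ Finset.range N, (f (Nat.pair x (0 + i)) : ℚ) := by
      rw [← hcard, Finset.card_eq_sum_ones]
      push_cast
      refine le_trans (Finset.sum_le_sum fun i hi => ?_)
        (Finset.sum_le_sum_of_subset_of_nonneg hN fun _ _ _ => by positivity)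
      rw [zero_add]
      exact_mod_cast Nat.one_le_iff_ne_zero.2 (hF hi)
    have h₂ := hC (t + 4)
    rw [hE] at h₂
    push_cast at h₁
    linarith
  · intro hfin
    obtain ⟨s₀, hs₀⟩ := hfin.bddAbove
    obtain ⟨M, hM⟩ := mainLoop_upper hP x (s₀ + 1) (fun s hs => by
      by_contra h
      have := hs₀ h
      omega) (s₀ + 1) 0 0 (by omega) η hη
    obtain ⟨c, hc⟩ := exists_nat_ge (4 + M)
    refine ⟨c, fun n => (En_mono (Nat.le_add_right n 4) _ _).trans ?_⟩
    rw [hE]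
    linarith [hM n]

/-! ### Hardness -/

theorem ratEquiv_natCast (n : ℕ) : ratEquiv (n : ℚ≥0) = 2 ^ n - 1 := by
  rw [ratEquiv, Equiv.symm_apply_eq, Equiv.ofBijective_apply]
  induction n with
  | zero => simp [ratOfNat]
  | succ n ih =>
    have := n.one_le_two_pow
    rw [show 2 ^ (n + 1) - 1 = 2 * (2 ^ n - 1) + 1 by omega, ratOfNat_odd, ← ih]
    push_cast
    rfl

theorem nat_pow_primrec : Primrec₂ ((· ^ ·) : ℕ → ℕ → ℕ) :=
  Primrec₂.unpaired'.1 Nat.Primrec.pow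

theorem mainProg_primrec (P : Prog) : Primrec (mainProg P) := by
  rw [← Primrec.encode_iff]
  have h : ∀ x, Encodable.encode (mainProg P x) = 4 * Nat.pair
      (4 * Nat.pair 2 (5 * (2 ^ x - 1)))
      (Encodable.encode (Prog.seq (.assign 1 (.const 1)) (mainLoop P))) + 1 := by
    intro x
    rw [← ratEquiv_natCast]
    rfl
  simp only [h]
  have h₁ : Primrec fun x : ℕ => 5 * (2 ^ x - 1) :=
    Primrec.nat_mul.comp (.const 5)
      (Primrec.nat_sub.comp (nat_pow_primrec.comp (.const 2) .id) (.const 1))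
  have h₂ : Primrec fun x : ℕ => 4 * Nat.pair 2 (5 * (2 ^ x - 1)) :=
    Primrec.nat_mul.comp (.const 4) (Primrec₂.natPair.comp (.const 2) h₁)
  exact Primrec.nat_add.comp
    (Primrec.nat_mul.comp (.const 4) (Primrec₂.natPair.comp h₂ (.const _))) (.const 1)

open Nat.Partrec in
/-- Within `t` steps, the computation `c` finds for every `y' ≤ y` a number `z ≤ t` such that the
value on `(n, [y', z])` is `0`. -/
def Refuted (c : Code) (n y t : ℕ) : Prop :=
  ∀ y' < y + 1, ∃ z < t + 1, Code.evaln t c (Nat.pair n (Encodable.encode [y', z])) = some 0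

open Nat.Partrec in
theorem refuted_primrec (c : Code) :
    PrimrecPred fun p : ℕ × ℕ × ℕ => Refuted c p.1 p.2.1 p.2.2 := by
  have h₁ : PrimrecRel fun (z : ℕ) (p : ℕ × ℕ × ℕ) =>
      Code.evaln p.2.2 c (Nat.pair p.2.1 (Encodable.encode [p.1, z])) = some 0 := by
    refine Primrec.eq.comp ?_ (.const _)
    refine Code.primrec_evaln.comp (f := fun q : (ℕ × Code) × ℕ => Code.evaln q.1.1 q.1.2 q.2)
      (g := fun q : ℕ × ℕ × ℕ × ℕ => ((q.2.2.2, c), Nat.pair q.2.2.1 (Encodable.encode [q.2.1, q.1])))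
      ?_
    refine .pair (.pair (Primrec.snd.comp (Primrec.snd.comp .snd)) (.const c)) ?_
    refine Primrec₂.natPair.comp (Primrec.fst.comp (Primrec.snd.comp .snd)) (Primrec.encode.comp ?_)
    exact Primrec.list_cons.comp (Primrec.fst.comp .snd)
      (Primrec.list_cons.comp .fst (.const []))
  have h₂ : PrimrecPred fun q : ℕ × ℕ × ℕ => ∃ z < q.2.2 + 1,
      Code.evaln q.2.2 c (Nat.pair q.2.1 (Encodable.encode [q.1, z])) = some 0 := by
    have h := h₁.exists_mem_list.comp (f := fun q : ℕ × ℕ × ℕ => List.range (q.2.2 + 1))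
      (g := fun q : ℕ × ℕ × ℕ => q)
      (Primrec.list_range.comp (Primrec.succ.comp (Primrec.snd.comp .snd))) .id
    simpa only [List.mem_range] using h
  have h₃ : PrimrecRel fun (y : ℕ) (p : ℕ × ℕ) =>
      ∃ z < p.2 + 1, Code.evaln p.2 c (Nat.pair p.1 (Encodable.encode [y, z])) = some 0 := h₂
  have h := h₃.forall_mem_list.comp (f := fun q : ℕ × ℕ × ℕ => List.range (q.2.1 + 1))
    (g := fun q : ℕ × ℕ × ℕ => (q.1, q.2.2))
    (Primrec.list_range.comp (Primrec.succ.comp (Primrec.fst.comp .snd)))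
    (.pair .fst (Primrec.snd.comp .snd))
  simp only [List.mem_range] at h
  exact h

theorem Refuted.mono {c : Nat.Partrec.Code} {n y t t' : ℕ} (h : Refuted c n y t) (ht : t ≤ t') :
    Refuted c n y t' := fun y' hy =>
  let ⟨z, hz, he⟩ := h y' hy
  ⟨z, by omega, Nat.Partrec.Code.evaln_mono ht he⟩

open Classical in
/-- The value is `1` if `t` is least such that `Refuted c n y t`, and otherwise `0`. -/
noncomputable def refutedAt (c : Nat.Partrec.Code) (n y t : ℕ) : ℕ :=
  if Refuted c n y t ∧ (t = 0 ∨ ¬ Refuted c n y (t - 1)) then 1 else 0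

theorem refutedAt_primrec (c : Nat.Partrec.Code) :
    Primrec fun p : ℕ × ℕ × ℕ => refutedAt c p.1 p.2.1 p.2.2 := by
  classical
  refine Primrec.ite (PrimrecPred.and (refuted_primrec c) (PrimrecPred.or ?_ ?_)) (.const 1) (.const 0)
  · exact Primrec.eq.comp (Primrec.snd.comp .snd) (.const 0)
  · exact PrimrecPred.not ((refuted_primrec c).comp
      (f := fun p : ℕ × ℕ × ℕ => (p.1, p.2.1, p.2.2 - 1))
      (.pair .fst (.pair (Primrec.fst.comp .snd) (Primrec.pred.comp (Primrec.snd.comp .snd)))))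

/-- Every `Σ₂⁰` set is many-one reducible to the finiteness of the support of a primitive
recursive function. -/
theorem exists_finite_support {β : Type} [Primcodable β] {C : β → Prop} (hC : IsSigma 2 C) :
    ∃ f : ℕ → ℕ, Nat.Primrec f ∧
      ∀ x, C x ↔ {s | f (Nat.pair (Encodable.encode x) s) ≠ 0}.Finite := by
  obtain ⟨R, ⟨_, hR⟩, hCR⟩ := hC
  obtain ⟨c, hc⟩ := Nat.Partrec.Code.exists_code.1 hR
  have hval : ∀ x y z, Nat.Partrec.Code.eval c (Nat.pair (Encodable.encode x) (Encodable.encode [y, z])) =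
      Part.some (Encodable.encode (decide (R (x, [y, z])))) := by
    intro x y z
    rw [hc, show Nat.pair (Encodable.encode x) (Encodable.encode [y, z]) =
      Encodable.encode (x, [y, z]) from rfl]
    beta_reduce
    rw [Encodable.encodek]
    simp
  have hev : ∀ x y z, (∃ t, Nat.Partrec.Code.evaln t c
      (Nat.pair (Encodable.encode x) (Encodable.encode [y, z])) = some 0) ↔ ¬ R (x, [y, z]) := by
    intro x y z
    have := Nat.Partrec.Code.evaln_complete (c := c)
      (n := Nat.pair (Encodable.encode x) (Encodable.encode [y, z])) (x := 0)
    simp only [Option.mem_def] at this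
    rw [← this, hval, Part.mem_some_iff]
    by_cases h : R (x, [y, z]) <;> simp [h]
  have hex : ∀ x y, (∃ t, Refuted c (Encodable.encode x) y t) ↔ ∀ y' ≤ y, ∃ z, ¬ R (x, [y', z]) := by
    intro x y
    constructor
    · rintro ⟨t, ht⟩ y' hy'
      obtain ⟨z, -, hz⟩ := ht y' (by omega)
      exact ⟨z, (hev x y' z).1 ⟨t, hz⟩⟩
    · intro h
      choose! z hz using h
      have h₁ : ∀ y' ≤ y, ∃ t, Nat.Partrec.Code.evaln t c
          (Nat.pair (Encodable.encode x) (Encodable.encode [y', z y'])) = some 0 :=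
        fun y' hy' => (hev x y' _).2 (hz y' hy')
      choose! t ht using h₁
      refine ⟨∑ i ∈ Finset.range (y + 1), (t i + z i), fun y' hy' => ⟨z y', ?_, ?_⟩⟩
      all_goals
        have := Finset.single_le_sum (f := fun i => t i + z i) (fun i _ => Nat.zero_le _)
          (Finset.mem_range.2 hy')
      · omega
      · exact Nat.Partrec.Code.evaln_mono (by omega) (ht y' (by omega))
  refine ⟨fun n => refutedAt c n.unpair.1 n.unpair.2.unpair.1 n.unpair.2.unpair.2, ?_, fun x => ?_⟩
  · rw [← Primrec.nat_iff]
    exact (refutedAt_primrec c).comp (f := fun p : ℕ × ℕ × ℕ => refutedAt c p.1 p.2.1 p.2.2)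
      (g := fun n : ℕ => (n.unpair.1, n.unpair.2.unpair.1, n.unpair.2.unpair.2))
      (.pair (Primrec.fst.comp .unpair) (Primrec.unpair.comp (Primrec.snd.comp .unpair)))
  · have hmem : ∀ s, s ∈ {s | refutedAt c (Nat.pair (Encodable.encode x) s).unpair.1
        (Nat.pair (Encodable.encode x) s).unpair.2.unpair.1
        (Nat.pair (Encodable.encode x) s).unpair.2.unpair.2 ≠ 0} ↔
        Refuted c (Encodable.encode x) s.unpair.1 s.unpair.2 ∧ (s.unpair.2 = 0 ∨
          ¬ Refuted c (Encodable.encode x) s.unpair.1 (s.unpair.2 - 1)) := by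
      intro s
      simp only [refutedAt, Nat.unpair_pair, Set.mem_ofPred_eq]
      split_ifs with h <;> simpa using h
    have hCx : C x ↔ ∃ y, ∀ z, R (x, [y, z]) := hCR x
    rw [hCx]
    constructor
    · rintro ⟨y₀, hy₀⟩
      refine Set.Finite.of_finite_image (f := fun s => s.unpair.1)
        ((Set.finite_lt_nat y₀).subset ?_) ?_
      · rintro _ ⟨s, hs, rfl⟩
        rw [hmem] at hs
        have h := (hex x _).1 ⟨_, hs.1⟩
        by_contra hlt
        obtain ⟨z, hz⟩ := h y₀ (by simpa using hlt)
        exact hz (hy₀ z)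
      · intro s hs s' hs' h
        rw [hmem] at hs hs'
        simp only at h
        rw [h] at hs
        suffices s.unpair.2 = s'.unpair.2 by
          rw [← Nat.pair_unpair s, ← Nat.pair_unpair s', h, this]
        rcases Nat.lt_trichotomy s.unpair.2 s'.unpair.2 with hlt | heq | hgt
        · rcases hs'.2 with h0 | h0
          · omega
          · exact absurd (hs.1.mono (by omega)) h0
        · exact heq
        · rcases hs.2 with h0 | h0
          · omega
          · exact absurd (hs'.1.mono (by omega)) h0
    · intro hfin
      by_contra hno
      push Not at hno
      have hall : ∀ y, ∃ t, Refuted c (Encodable.encode x) y t := fun y =>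
        (hex x y).2 fun y' _ => hno y'
      classical
      refine Set.infinite_of_injective_forall_mem
        (f := fun y => Nat.pair y (Nat.find (hall y))) ?_ ?_ hfin
      · intro y y' h
        exact (Nat.pair_eq_pair.1 h).1
      · intro y
        rw [hmem]
        simp only [Nat.unpair_pair]
        refine ⟨Nat.find_spec (hall y), ?_⟩
        rcases Nat.eq_zero_or_pos (Nat.find (hall y)) with h | h
        · exact .inl h
        · exact .inr (Nat.find_min (hall y) (by omega))

theorem past_isSigmaHard : IsSigmaHard 2 PAST := by
  intro β _ C hC
  obtain ⟨f, hf, hCf⟩ := exists_finite_support hC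
  obtain ⟨P, hP⟩ := exists_computes hf 5 (by norm_num)
  refine ⟨fun b => (mainProg P (Encodable.encode b), 0), ?_, fun b => ?_⟩
  · exact (Primrec.pair ((mainProg_primrec P).comp Primrec.encode) (.const 0)).to_comp
  · rw [hCf, past_mainProg_iff hP]

/-! ### Closure properties of the primitive recursive functions, for `fun_prop` -/

section Primrec

variable {α β γ σ : Type} [Primcodable α] [Primcodable β] [Primcodable γ] [Primcodable σ]

attribute [fun_prop] Primrec Primrec.const Primrec.comp Primrec.pair Primrec.encode

@[fun_prop] theorem primrec_id : Primrec fun x : α => x := Primrec.id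

@[fun_prop] theorem primrec_fst {f : α → β × γ} (hf : Primrec f) : Primrec fun x => (f x).1 :=
  Primrec.fst.comp hf

@[fun_prop] theorem primrec_snd {f : α → β × γ} (hf : Primrec f) : Primrec fun x => (f x).2 :=
  Primrec.snd.comp hf

@[fun_prop] theorem primrec_add {f g : α → ℕ} (hf : Primrec f) (hg : Primrec g) :
    Primrec fun x => f x + g x := Primrec.nat_add.comp hf hg

@[fun_prop] theorem primrec_sub {f g : α → ℕ} (hf : Primrec f) (hg : Primrec g) :
    Primrec fun x => f x - g x := Primrec.nat_sub.comp hf hg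

@[fun_prop] theorem primrec_mul {f g : α → ℕ} (hf : Primrec f) (hg : Primrec g) :
    Primrec fun x => f x * g x := Primrec.nat_mul.comp hf hg

@[fun_prop] theorem primrec_div {f g : α → ℕ} (hf : Primrec f) (hg : Primrec g) :
    Primrec fun x => f x / g x := Primrec.nat_div.comp hf hg

@[fun_prop] theorem primrec_mod {f g : α → ℕ} (hf : Primrec f) (hg : Primrec g) :
    Primrec fun x => f x % g x := Primrec.nat_mod.comp hf hg

@[fun_prop] theorem primrec_unpair {f : α → ℕ} (hf : Primrec f) :
    Primrec fun x => (f x).unpair := Primrec.unpair.comp hf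

@[fun_prop] theorem primrec_beq {f g : α → ℕ} (hf : Primrec f) (hg : Primrec g) :
    Primrec fun x => Nat.beq (f x) (g x) :=
  (Primrec.beq.comp hf hg).of_eq fun x => by rw [Bool.eq_iff_iff]; simp

@[fun_prop] theorem primrec_ble {f g : α → ℕ} (hf : Primrec f) (hg : Primrec g) :
    Primrec fun x => Nat.ble (f x) (g x) :=
  (Primrec.nat_le.decide.comp hf hg).of_eq fun x => by
    rw [Bool.eq_iff_iff, Nat.ble_eq, decide_eq_true_eq]

@[fun_prop] theorem primrec_bnot {f : α → Bool} (hf : Primrec f) : Primrec fun x => !f x :=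
  Primrec.not.comp hf

@[fun_prop] theorem primrec_band {f g : α → Bool} (hf : Primrec f) (hg : Primrec g) :
    Primrec fun x => f x && g x := Primrec.and.comp hf hg

@[fun_prop] theorem primrec_cond {c : α → Bool} {f g : α → σ} (hc : Primrec c) (hf : Primrec f)
    (hg : Primrec g) : Primrec fun x => bif c x then f x else g x := Primrec.cond hc hf hg

@[fun_prop] theorem primrec_cons {f : α → β} {g : α → List β} (hf : Primrec f) (hg : Primrec g) :
    Primrec fun x => f x :: g x := Primrec.list_cons.comp hf hg

@[fun_prop] theorem primrec_length {f : α → List β} (hf : Primrec f) :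
    Primrec fun x => (f x).length := Primrec.list_length.comp hf

@[fun_prop] theorem primrec_headD {f : α → List β} {g : α → β} (hf : Primrec f) (hg : Primrec g) :
    Primrec fun x => (f x).headD (g x) :=
  (Primrec.option_getD.comp (Primrec.list_head?.comp hf) hg).of_eq fun x => by
    cases f x <;> rfl

@[fun_prop] theorem primrec_tail {f : α → List β} (hf : Primrec f) :
    Primrec fun x => (f x).tail := Primrec.list_tail.comp hf

@[fun_prop] theorem primrec_getD {f : α → List β} {g : α → ℕ} (d : β) (hf : Primrec f)
    (hg : Primrec g) : Primrec fun x => (f x).getD (g x) d := (Primrec.list_getD d).comp hf hg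

@[fun_prop] theorem primrec_optionGetD {f : α → Option β} {g : α → β} (hf : Primrec f)
    (hg : Primrec g) : Primrec fun x => (f x).getD (g x) := Primrec.option_getD.comp hf hg

@[fun_prop] theorem primrec_lookup {f : α → ℕ} {g : α → List (ℕ × β)} (hf : Primrec f)
    (hg : Primrec g) : Primrec fun x => (g x).lookup (f x) :=
  (Primrec.listLookup.comp hf hg).of_eq fun _ => rfl

@[fun_prop] theorem primrec_map {f : α → List β} {g : α → β → σ} (hf : Primrec f)
    (hg : Primrec fun p : α × β => g p.1 p.2) : Primrec fun x => (f x).map (g x) :=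
  Primrec.list_map hf hg

@[fun_prop] theorem primrec_flatMap {f : α → List β} {g : α → β → List σ} (hf : Primrec f)
    (hg : Primrec fun p : α × β => g p.1 p.2) : Primrec fun x => (f x).flatMap (g x) :=
  Primrec.list_flatMap hf hg

@[fun_prop] theorem primrec_foldr {f : α → List β} {g : α → σ} {h : α → β → σ → σ}
    (hf : Primrec f) (hg : Primrec g) (hh : Primrec fun p : α × β × σ => h p.1 p.2.1 p.2.2) :
    Primrec fun x => (f x).foldr (h x) (g x) :=
  Primrec.list_foldr (h := fun a p => h a p.1 p.2) hf hg hh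

@[fun_prop] theorem primrec_foldl {f : α → List β} {g : α → σ} {h : α → σ → β → σ}
    (hf : Primrec f) (hg : Primrec g) (hh : Primrec fun p : α × σ × β => h p.1 p.2.1 p.2.2) :
    Primrec fun x => (f x).foldl (h x) (g x) :=
  Primrec.list_foldl (h := fun a p => h a p.1 p.2) hf hg hh

@[fun_prop] theorem primrec_iterate {f : α → ℕ} {g : α → β} {h : α → β → β} (hf : Primrec f)
    (hg : Primrec g) (hh : Primrec fun p : α × β => h p.1 p.2) :
    Primrec fun x => (h x)^[f x] (g x) := Primrec.nat_iterate hf hg hh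

/-- Course-of-values recursion. -/
theorem primrec_strongRec (f : α → ℕ → σ) (g : α → List σ → σ)
    (hg : Primrec fun p : α × List σ => g p.1 p.2)
    (H : ∀ a n, f a n = g a ((List.range n).map (f a))) :
    Primrec fun p : α × ℕ => f p.1 p.2 :=
  Primrec.nat_strong_rec f (g := fun a l => some (g a l)) (Primrec.option_some.comp hg)
    fun a n => by rw [H]

end Primrec

theorem getD_map_range {σ : Type} (f : ℕ → σ) (d : σ) {m n : ℕ} (h : m < n) :
    ((List.range n).map f).getD m d = f m := by
  simp [List.getD, h]

/-! ### Evaluation of expressions, in terms of Gödel numbers -/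

/-- Numerator and denominator of `ratOfNat n`. -/
def ratPair : ℕ → ℕ × ℕ
  | 0 => (0, 1)
  | n + 1 =>
      bif Nat.beq ((n + 1) % 2) 1 then
        ((ratPair ((n + 1) / 2)).1 + (ratPair ((n + 1) / 2)).2, (ratPair ((n + 1) / 2)).2)
      else ((ratPair ((n + 1) / 2)).1, (ratPair ((n + 1) / 2)).1 + (ratPair ((n + 1) / 2)).2)
  decreasing_by all_goals omega

theorem ratPair_primrec : Primrec ratPair := by
  have h := primrec_strongRec (α := Unit) (fun _ => ratPair) (fun _ l =>
    bif Nat.beq l.length 0 then (0, 1) else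
      bif Nat.beq (l.length % 2) 1 then
        ((l.getD (l.length / 2) (0, 1)).1 + (l.getD (l.length / 2) (0, 1)).2,
          (l.getD (l.length / 2) (0, 1)).2)
      else ((l.getD (l.length / 2) (0, 1)).1,
        (l.getD (l.length / 2) (0, 1)).1 + (l.getD (l.length / 2) (0, 1)).2))
    (by fun_prop) fun _ n => by
      cases n with
      | zero => simp [ratPair]
      | succ n =>
        rw [ratPair, List.length_map, List.length_range, getD_map_range _ _ (by omega)]
        rfl
  exact h.comp (f := fun p : Unit × ℕ => ratPair p.2) (g := fun n : ℕ => ((), n))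
    (by fun_prop)

theorem ratPair_pos (n : ℕ) : 0 < (ratPair n).2 := by
  induction n using Nat.strong_induction_on with
  | _ n ih =>
    cases n with
    | zero => simp [ratPair]
    | succ n =>
      have := ih ((n + 1) / 2) (by omega)
      rw [ratPair]
      cases Nat.beq ((n + 1) % 2) 1
      · exact Nat.add_pos_right _ this
      · exact this

theorem ratPair_eq (n : ℕ) : ((ratPair n).1 : ℚ≥0) / (ratPair n).2 = ratOfNat n := by
  induction n using Nat.strong_induction_on with
  | _ n ih =>
    cases n with
    | zero => simp [ratPair, ratOfNat]
    | succ n =>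
      have h := ih ((n + 1) / 2) (by omega)
      have hp : ((ratPair ((n + 1) / 2)).2 : ℚ≥0) ≠ 0 := by
        exact_mod_cast (ratPair_pos ((n + 1) / 2)).ne'
      rw [ratPair, ratOfNat, ← h]
      split_ifs with hm
      · rw [show Nat.beq ((n + 1) % 2) 1 = true by simp [hm], cond_true]
        push_cast
        field_simp
      · rw [show Nat.beq ((n + 1) % 2) 1 = false by
          rw [Bool.eq_false_iff]; simpa using hm, cond_false]
        push_cast
        field_simp

/-- Finite lists of assignments of fractions to variables. -/
abbrev Store : Type := List (ℕ × ℕ × ℕ)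

/-- The fraction that is assigned to `v`. -/
def Store.look (st : Store) (v : ℕ) : ℕ × ℕ := (st.lookup v).getD (0, 1)

@[fun_prop] theorem look_primrec {α : Type} [Primcodable α] {f : α → Store} {g : α → ℕ}
    (hf : Primrec f) (hg : Primrec g) : Primrec fun x => (f x).look (g x) := by
  unfold Store.look
  fun_prop

/-- The store `st` represents the valuation `η`. -/
def Store.Rep (st : Store) (η : Val) : Prop :=
  ∀ v, 0 < (st.look v).2 ∧ ((st.look v).1 : ℚ≥0) / (st.look v).2 = η v

theorem Store.Rep.cons {st : Store} {η : Val} (h : st.Rep η) (v a b : ℕ) (hb : 0 < b) {q : ℚ}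
    (hq : (a : ℚ≥0) / b = q.toNNRat) : Store.Rep ((v, a, b) :: st) (assignVal η v q) := by
  intro u
  rw [assignVal_apply]
  by_cases hu : u = v
  · subst hu
    simp [Store.look, hb, hq]
  · have : (u == v) = false := by simpa using hu
    rw [if_neg hu, Store.look, List.lookup_cons, this]
    exact h u

/-- The rational number `(a - b) / d`. -/
def fracVal (r : ℕ × ℕ × ℕ) : ℚ := ((r.1 : ℚ) - r.2.1) / r.2.2

/-- The value of the expression with the number `n`, where `r` and `s` are the values of its
operands. -/
def evalBody (st : Store) (n : ℕ) (r s : ℕ × ℕ × ℕ) : ℕ × ℕ × ℕ :=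
  bif Nat.beq (n % 5) 0 then ((ratPair (n / 5)).1, 0, (ratPair (n / 5)).2)
  else bif Nat.beq (n % 5) 1 then ((st.look (n / 5)).1, 0, (st.look (n / 5)).2)
  else bif Nat.beq (n % 5) 2 then
    (r.1 * s.2.2 + s.1 * r.2.2, r.2.1 * s.2.2 + s.2.1 * r.2.2, r.2.2 * s.2.2)
  else bif Nat.beq (n % 5) 3 then
    (r.1 * s.2.2 + s.2.1 * r.2.2, r.2.1 * s.2.2 + s.1 * r.2.2, r.2.2 * s.2.2)
  else (r.1 * s.1 + r.2.1 * s.2.1, r.1 * s.2.1 + r.2.1 * s.1, r.2.2 * s.2.2)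

/-- The fraction `(a - b) / d` that is the value of the expression with a given number. -/
def evalCode (st : Store) (n : ℕ) : ℕ × ℕ × ℕ :=
  if h : n = 0 then evalBody st 0 (0, 0, 1) (0, 0, 1) else
    have h₁ : (n / 5).unpair.1 < n := lt_of_le_of_lt (Nat.unpair_left_le _) (by omega)
    have h₂ : (n / 5).unpair.2 < n := lt_of_le_of_lt (Nat.unpair_right_le _) (by omega)
    evalBody st n (evalCode st (n / 5).unpair.1) (evalCode st (n / 5).unpair.2)
  termination_by n

theorem evalCode_eq (st : Store) (n : ℕ) : evalCode st n =
    evalBody st n (evalCode st (n / 5).unpair.1) (evalCode st (n / 5).unpair.2) := by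
  by_cases h : n = 0
  · subst h
    rw [evalCode]
    rfl
  · rw [evalCode, dif_neg h]

attribute [fun_prop] ratPair_primrec

theorem evalCode_primrec : Primrec fun p : Store × ℕ => evalCode p.1 p.2 := by
  refine primrec_strongRec evalCode (fun st l => evalBody st l.length
    (l.getD (l.length / 5).unpair.1 (0, 0, 1)) (l.getD (l.length / 5).unpair.2 (0, 0, 1)))
    (by unfold evalBody; fun_prop) fun st n => ?_
  rw [List.length_map, List.length_range]
  by_cases h : n = 0
  · subst h
    rw [evalCode]
    rfl
  · have h₁ : (n / 5).unpair.1 < n := lt_of_le_of_lt (Nat.unpair_left_le _) (by omega)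
    have h₂ : (n / 5).unpair.2 < n := lt_of_le_of_lt (Nat.unpair_right_le _) (by omega)
    rw [evalCode_eq, getD_map_range _ _ h₁, getD_map_range _ _ h₂]

theorem evalCode_toNat {st : Store} {η : Val} (h : st.Rep η) (e : AExpr) :
    0 < (evalCode st e.toNat).2.2 ∧ fracVal (evalCode st e.toNat) = e.eval η := by
  induction e with
  | const q =>
    have h₁ := ratPair_pos (ratEquiv q)
    have h₂ := ratPair_eq (ratEquiv q)
    rw [show ratOfNat (ratEquiv q) = q from ratEquiv.symm_apply_apply q] at h₂
    rw [evalCode_eq, AExpr.toNat, evalBody, Nat.mul_mod_right,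
      Nat.mul_div_cancel_left _ (by norm_num)]
    refine ⟨h₁, ?_⟩
    change fracVal ((ratPair (ratEquiv q)).1, 0, (ratPair (ratEquiv q)).2) = q
    simpa [fracVal] using congrArg (fun x : ℚ≥0 => (x : ℚ)) h₂
  | var v =>
    obtain ⟨h₁, h₂⟩ := h v
    rw [evalCode_eq, AExpr.toNat, evalBody, Nat.mul_add_mod, Nat.mul_add_div (by norm_num)]
    refine ⟨h₁, ?_⟩
    change fracVal ((st.look v).1, 0, (st.look v).2) = η v
    simpa [fracVal] using congrArg (fun x : ℚ≥0 => (x : ℚ)) h₂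
  | add e₁ e₂ ih₁ ih₂ | sub e₁ e₂ ih₁ ih₂ | mul e₁ e₂ ih₁ ih₂ =>
    rw [evalCode_eq, AExpr.toNat, evalBody, Nat.mul_add_mod, Nat.mul_add_div (by norm_num)]
    obtain ⟨h₁, h₁'⟩ := ih₁
    obtain ⟨h₂, h₂'⟩ := ih₂
    have h₃ : ((evalCode st e₁.toNat).2.2 : ℚ) ≠ 0 := by exact_mod_cast h₁.ne'
    have h₄ : ((evalCode st e₂.toNat).2.2 : ℚ) ≠ 0 := by exact_mod_cast h₂.ne'
    rw [AExpr.eval, ← h₁', ← h₂', Nat.div_eq_of_lt (by norm_num), Nat.add_zero, Nat.unpair_pair]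
    refine ⟨Nat.mul_pos h₁ h₂, ?_⟩
    simp only [Nat.beq, cond_true, cond_false, fracVal]
    push_cast
    field_simp
    ring

/-- The truth value of the Boolean expression with the number `n`, where `t`, `t₁` and `t₂` are the
truth values of its subexpressions. -/
def testBody (st : Store) (n : ℕ) (t t₁ t₂ : Bool) : Bool :=
  let r := evalCode st (n / 4).unpair.1
  let s := evalCode st (n / 4).unpair.2
  bif Nat.beq (n % 4) 0 then Nat.beq (r.1 * s.2.2 + s.2.1 * r.2.2) (s.1 * r.2.2 + r.2.1 * s.2.2)
  else bif Nat.beq (n % 4) 1 then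
    Nat.ble (r.1 * s.2.2 + s.2.1 * r.2.2) (s.1 * r.2.2 + r.2.1 * s.2.2)
  else bif Nat.beq (n % 4) 2 then !t else t₁ && t₂

/-- The truth value of the Boolean expression with a given number. -/
def testCode (st : Store) (n : ℕ) : Bool :=
  if h : n = 0 then testBody st 0 false false false else
    have h₀ : n / 4 < n := by omega
    have h₁ : (n / 4).unpair.1 < n := lt_of_le_of_lt (Nat.unpair_left_le _) (by omega)
    have h₂ : (n / 4).unpair.2 < n := lt_of_le_of_lt (Nat.unpair_right_le _) (by omega)
    testBody st n (testCode st (n / 4)) (testCode st (n / 4).unpair.1)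
      (testCode st (n / 4).unpair.2)
  termination_by n

theorem testCode_eq (st : Store) (n : ℕ) : testCode st n =
    testBody st n (testCode st (n / 4)) (testCode st (n / 4).unpair.1)
      (testCode st (n / 4).unpair.2) := by
  by_cases h : n = 0
  · subst h
    rw [testCode]
    rfl
  · rw [testCode, dif_neg h]

@[fun_prop] theorem primrec_evalCode {α : Type} [Primcodable α] {f : α → Store} {g : α → ℕ}
    (hf : Primrec f) (hg : Primrec g) : Primrec fun x => evalCode (f x) (g x) :=
  evalCode_primrec.comp (f := fun p : Store × ℕ => evalCode p.1 p.2) (g := fun x => (f x, g x))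
    (by fun_prop)

theorem testCode_primrec : Primrec fun p : Store × ℕ => testCode p.1 p.2 := by
  refine primrec_strongRec testCode (fun st l => testBody st l.length (l.getD (l.length / 4) false)
    (l.getD (l.length / 4).unpair.1 false) (l.getD (l.length / 4).unpair.2 false))
    (by unfold testBody; fun_prop) fun st n => ?_
  rw [List.length_map, List.length_range]
  by_cases h : n = 0
  · subst h
    rw [testCode]
    rfl
  · have h₀ : n / 4 < n := by omega
    have h₁ : (n / 4).unpair.1 < n := lt_of_le_of_lt (Nat.unpair_left_le _) (by omega)
    have h₂ : (n / 4).unpair.2 < n := lt_of_le_of_lt (Nat.unpair_right_le _) (by omega)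
    rw [testCode_eq, getD_map_range _ _ h₀, getD_map_range _ _ h₁, getD_map_range _ _ h₂]

theorem fracVal_le_iff {r s : ℕ × ℕ × ℕ} (hr : 0 < r.2.2) (hs : 0 < s.2.2) :
    fracVal r ≤ fracVal s ↔ r.1 * s.2.2 + s.2.1 * r.2.2 ≤ s.1 * r.2.2 + r.2.1 * s.2.2 := by
  have hr' : (0 : ℚ) < r.2.2 := by exact_mod_cast hr
  have hs' : (0 : ℚ) < s.2.2 := by exact_mod_cast hs
  rw [fracVal, fracVal, div_le_div_iff₀ hr' hs', ← Nat.cast_le (α := ℚ)]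
  push_cast
  constructor <;> intro h <;> linarith

theorem fracVal_eq_iff {r s : ℕ × ℕ × ℕ} (hr : 0 < r.2.2) (hs : 0 < s.2.2) :
    fracVal r = fracVal s ↔ r.1 * s.2.2 + s.2.1 * r.2.2 = s.1 * r.2.2 + r.2.1 * s.2.2 := by
  rw [le_antisymm_iff, fracVal_le_iff hr hs, fracVal_le_iff hs hr]
  omega

theorem testCode_toNat {st : Store} {η : Val} (h : st.Rep η) (b : BExpr) :
    testCode st b.toNat = b.eval η := by
  induction b with
  | eq e₁ e₂ =>
    obtain ⟨h₁, h₁'⟩ := evalCode_toNat h e₁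
    obtain ⟨h₂, h₂'⟩ := evalCode_toNat h e₂
    rw [testCode_eq, BExpr.toNat, testBody, Nat.mul_mod_right,
      Nat.mul_div_cancel_left _ (by norm_num), BExpr.eval, ← h₁', ← h₂', Bool.eq_iff_iff,
      decide_eq_true_eq, fracVal_eq_iff h₁ h₂, Nat.unpair_pair]
    exact Iff.of_eq Nat.beq_eq
  | le e₁ e₂ =>
    obtain ⟨h₁, h₁'⟩ := evalCode_toNat h e₁
    obtain ⟨h₂, h₂'⟩ := evalCode_toNat h e₂
    rw [testCode_eq, BExpr.toNat, testBody, Nat.mul_add_mod, Nat.mul_add_div (by norm_num),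
      Nat.div_eq_of_lt (by norm_num), Nat.add_zero, BExpr.eval, ← h₁', ← h₂', Bool.eq_iff_iff,
      decide_eq_true_eq, fracVal_le_iff h₁ h₂, Nat.unpair_pair]
    exact Iff.of_eq Nat.ble_eq
  | not b ih =>
    rw [testCode_eq, BExpr.toNat, testBody, Nat.mul_add_mod, Nat.mul_add_div (by norm_num),
      Nat.div_eq_of_lt (by norm_num), Nat.add_zero, BExpr.eval, ← ih]
    rfl
  | and b₁ b₂ ih₁ ih₂ =>
    rw [testCode_eq, BExpr.toNat, testBody, Nat.mul_add_mod, Nat.mul_add_div (by norm_num),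
      Nat.div_eq_of_lt (by norm_num), Nat.add_zero, BExpr.eval, ← ih₁, ← ih₂, Nat.unpair_pair]
    rfl

@[fun_prop] theorem primrec_testCode {α : Type} [Primcodable α] {f : α → Store} {g : α → ℕ}
    (hf : Primrec f) (hg : Primrec g) : Primrec fun x => testCode (f x) (g x) :=
  testCode_primrec.comp (f := fun p : Store × ℕ => testCode p.1 p.2) (g := fun x => (f x, g x))
    (by fun_prop)

/-! ### Runs of programs, in terms of Gödel numbers -/

/-- Replaces `P ; Q` by `P`, and adds `Q` to the list. -/
def unrollStep (p : ℕ × List ℕ) : ℕ × List ℕ :=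
  bif Nat.beq (p.1 % 4) 1 then ((p.1 / 4).unpair.1, (p.1 / 4).unpair.2 :: p.2) else p

/-- Applies `unrollStep` until the program is not a concatenation. -/
def unroll (p : ℕ × List ℕ) : ℕ × List ℕ := unrollStep^[p.1] p

theorem toNat_seq (P Q : Prog) : (Prog.seq P Q).toNat = 4 * Nat.pair P.toNat Q.toNat + 1 := rfl

theorem mul_four_add (m : ℕ) {i : ℕ} (hi : i < 4) : (4 * m + i) % 4 = i ∧ (4 * m + i) / 4 = m := by
  omega

theorem unroll_toNat (P : Prog) (l : List Prog) :
    ∃ (Q : Prog) (l' : List Prog), (∀ A B, Q ≠ .seq A B) ∧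
      unroll (P.toNat, l.map Prog.toNat) = (Q.toNat, l'.map Prog.toNat) ∧
      plug P.toCmd l = plug Q.toCmd l' := by
  have key : ∀ k, P.toNat ≤ k → ∃ (Q : Prog) (l' : List Prog), (∀ A B, Q ≠ .seq A B) ∧
      unrollStep^[k] (P.toNat, l.map Prog.toNat) = (Q.toNat, l'.map Prog.toNat) ∧
      plug P.toCmd l = plug Q.toCmd l' := by
    induction P generalizing l with
    | seq P Q ih _ =>
      intro k hk
      rw [toNat_seq] at hk
      obtain ⟨k, rfl⟩ := Nat.exists_eq_succ_of_ne_zero (show k ≠ 0 by omega)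
      obtain ⟨R, l', hR, h₁, h₂⟩ := ih (Q :: l) k
        ((Nat.left_le_pair P.toNat Q.toNat).trans (by omega))
      refine ⟨R, l', hR, ?_, h₂⟩
      rw [Function.iterate_succ_apply, ← h₁, toNat_seq, unrollStep,
        (mul_four_add _ (by norm_num)).1, (mul_four_add _ (by norm_num)).2, Nat.unpair_pair]
      rfl
    | assign v e =>
      refine fun k _ => ⟨_, l, by simp, Function.iterate_fixed ?_ _, rfl⟩
      rw [Prog.toNat, unrollStep, Nat.mul_mod_right]
      rfl
    | choice P p Q =>
      refine fun k _ => ⟨_, l, by simp, Function.iterate_fixed ?_ _, rfl⟩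
      rw [Prog.toNat, unrollStep, (mul_four_add _ (by norm_num)).1]
      rfl
    | loop b P =>
      refine fun k _ => ⟨_, l, by simp, Function.iterate_fixed ?_ _, rfl⟩
      rw [Prog.toNat, unrollStep, (mul_four_add _ (by norm_num)).1]
      rfl
  exact key _ le_rfl

/-- The value of a fraction. -/
def fv (a : ℕ × ℕ) : ℚ := (a.1 : ℚ) / a.2

/-- The fraction that is the rational probability with the number `n`. -/
def probPair (n : ℕ) : ℕ × ℕ :=
  bif Nat.beq n 0 then (1, 1)
  else ((ratPair (n - 1)).1, (ratPair (n - 1)).1 + (ratPair (n - 1)).2)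

theorem probPair_spec (n : ℕ) :
    0 < (probPair n).2 ∧ (probPair n).1 ≤ (probPair n).2 ∧
      fv (probPair n) = (probEquiv.symm n : ℚ) := by
  change _ ∧ _ ∧ _ = ((Prob.ofNat n : Prob) : ℚ)
  cases n with
  | zero => simp [probPair, fv, Prob.ofNat]
  | succ n =>
    have h := ratPair_pos n
    have h₁ : (0 : ℚ) < (ratPair n).2 := by exact_mod_cast h
    have h₂ : ((ratEquiv.symm n : ℚ≥0) : ℚ) = ((ratPair n).1 : ℚ) / (ratPair n).2 := by
      have := congrArg (fun x : ℚ≥0 => (x : ℚ)) (ratPair_eq n)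
      simp only [NNRat.cast_div, NNRat.cast_natCast] at this
      exact this.symm
    change 0 < (ratPair n).1 + (ratPair n).2 ∧ (ratPair n).1 ≤ (ratPair n).1 + (ratPair n).2 ∧
      ((ratPair n).1 : ℚ) / (((ratPair n).1 + (ratPair n).2 : ℕ) : ℚ) =
        (ratEquiv.symm n : ℚ) / ((ratEquiv.symm n : ℚ) + 1)
    refine ⟨by omega, by omega, ?_⟩
    rw [h₂]
    push_cast
    field_simp

/-- Representations of configurations: the number `0` or `P.toNat + 1`, the numbers of the
programs that follow, and the values of the variables. -/
abbrev Conf : Type := ℕ × List ℕ × Store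

/-- `c` represents the command `C` and the valuation `η`. -/
def Repr (c : Conf) (C : Cmd) (η : Val) : Prop :=
  c.2.2.Rep η ∧ ∃ l : List Prog, c.2.1 = l.map Prog.toNat ∧
    ((c.1 = 0 ∧ C = plug .term l) ∨ ∃ P : Prog, c.1 = P.toNat + 1 ∧ C = plug P.toCmd l)

/-- The successors of the configuration in which a program is to be executed that is not a
concatenation. -/
def stepProg (u : ℕ × List ℕ) (st : Store) : List ((ℕ × ℕ) × Conf) :=
  let m := (u.1 / 4).unpair
  bif Nat.beq (u.1 % 4) 0 then
    [((1, 1), 0, u.2, (m.1, (evalCode st m.2).1 - (evalCode st m.2).2.1, (evalCode st m.2).2.2) :: st)]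
  else bif Nat.beq (u.1 % 4) 2 then
    [(probPair m.1, m.2.unpair.1 + 1, u.2, st),
      (((probPair m.1).2 - (probPair m.1).1, (probPair m.1).2), m.2.unpair.2 + 1, u.2, st)]
  else bif testCode st m.1 then [((1, 1), m.2 + 1, u.1 :: u.2, st)] else [((1, 1), 0, u.2, st)]

/-- The successors of a configuration. -/
def stepConf (c : Conf) : List ((ℕ × ℕ) × Conf) :=
  bif Nat.beq c.1 0 then
    bif Nat.beq c.2.1.length 0 then [] else [((1, 1), c.2.1.headD 0 + 1, c.2.1.tail, c.2.2)]
  else stepProg (unroll (c.1 - 1, c.2.1)) c.2.2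

@[fun_prop] theorem stepConf_primrec {α : Type} [Primcodable α] {f : α → Conf} (hf : Primrec f) :
    Primrec fun x => stepConf (f x) := by
  unfold stepConf stepProg unroll unrollStep probPair
  fun_prop

/-- The relation between weighted configurations and their representations. -/
def WRepr (s : (ℕ × ℕ) × Conf) (t : ℚ × Cmd × Val) : Prop :=
  0 < s.1.2 ∧ fv s.1 = t.1 ∧ Repr s.2 t.2.1 t.2.2

theorem WRepr.one {c : Conf} {C : Cmd} {η : Val} (h : Repr c C η) : WRepr ((1, 1), c) (1, C, η) :=
  ⟨Nat.one_pos, by simp [fv], h⟩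

theorem stepProg_spec {st : Store} {η : Val} (hst : st.Rep η) (P : Prog)
    (hP : ∀ A B, P ≠ .seq A B) (l : List Prog) :
    List.Forall₂ WRepr (stepProg (P.toNat, l.map Prog.toNat) st) (succs (plug P.toCmd l) η) := by
  cases P with
  | seq A B => exact absurd rfl (hP A B)
  | assign v e =>
    obtain ⟨h₁, h₂⟩ := evalCode_toNat hst e
    rw [succs_plug _ (by simp [Prog.toCmd]), Prog.toNat, stepProg, Nat.mul_mod_right,
      Nat.mul_div_cancel_left _ (by norm_num), Nat.unpair_pair]
    refine .cons (.one ⟨hst.cons _ _ _ h₁ ?_, l, rfl, .inl ⟨rfl, rfl⟩⟩) .nil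
    change (((evalCode st e.toNat).1 - (evalCode st e.toNat).2.1 : ℕ) : ℚ≥0) /
      (evalCode st e.toNat).2.2 = _
    rw [← h₂, fracVal, Rat.toNNRat_div' (by positivity), toNNRat_sub_natCast]
    simp
  | choice A p B =>
    obtain ⟨h₁, h₂, h₃⟩ := probPair_spec (probEquiv p)
    rw [Equiv.symm_apply_apply] at h₃
    rw [succs_plug _ (by simp [Prog.toCmd]), Prog.toNat, stepProg,
      (mul_four_add _ (by norm_num)).1, (mul_four_add _ (by norm_num)).2]
    simp only [Nat.unpair_pair]
    refine .cons ⟨h₁, h₃, hst, l, rfl, .inr ⟨A, rfl, rfl⟩⟩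
      (.cons ⟨h₁, ?_, hst, l, rfl, .inr ⟨B, rfl, rfl⟩⟩ .nil)
    have h₄ : ((probPair (probEquiv p)).2 : ℚ) ≠ 0 := by exact_mod_cast h₁.ne'
    change fv ((probPair (probEquiv p)).2 - (probPair (probEquiv p)).1, (probPair (probEquiv p)).2) =
      1 - (p : ℚ)
    rw [← h₃, fv, fv, Nat.cast_sub h₂]
    field_simp
  | loop b A =>
    rw [succs_plug _ (by simp [Prog.toCmd]), Prog.toNat, stepProg,
      (mul_four_add _ (by norm_num)).1, (mul_four_add _ (by norm_num)).2, Nat.unpair_pair]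
    have h := testCode_toNat hst b
    change testCode st (Encodable.encode b) = _ at h
    rw [Prog.toCmd, succs]
    simp only [h]
    cases b.eval η
    · exact .cons (.one ⟨hst, l, rfl, .inl ⟨rfl, rfl⟩⟩) .nil
    · exact .cons (.one ⟨hst, .loop b A :: l, rfl, .inr ⟨A, rfl, rfl⟩⟩) .nil

theorem stepConf_spec {c : Conf} {C : Cmd} {η : Val} (h : Repr c C η) :
    List.Forall₂ WRepr (stepConf c) (succs C η) := by
  obtain ⟨n, l', st⟩ := c
  obtain ⟨hst, l, rfl, ⟨rfl, rfl⟩ | ⟨P, rfl, rfl⟩⟩ := h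
  · cases l with
    | nil => exact .nil
    | cons Q l =>
      rw [plug_cons, succs_plug _ (by simp)]
      exact .cons (.one ⟨hst, l, rfl, .inr ⟨Q, rfl, rfl⟩⟩) .nil
  · obtain ⟨Q, l', hQ, h₁, h₂⟩ := unroll_toNat P l
    change List.Forall₂ WRepr (stepProg (unroll (P.toNat, l.map Prog.toNat)) st) _
    rw [h₁, h₂]
    exact stepProg_spec hst Q hQ l'

/-- Whether a configuration is terminal. -/
def isFinal (c : Conf) : Bool := Nat.beq c.1 0 && Nat.beq c.2.1.length 0

theorem toCmd_ne_term (P : Prog) : P.toCmd ≠ .term := by cases P <;> simp [Prog.toCmd]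

theorem isFinal_spec {c : Conf} {C : Cmd} {η : Val} (h : Repr c C η) :
    isFinal c = true ↔ C = .term := by
  obtain ⟨n, l', st⟩ := c
  obtain ⟨hst, l, rfl, ⟨rfl, rfl⟩ | ⟨P, rfl, rfl⟩⟩ := h
  · cases l with
    | nil => simp [isFinal]
    | cons Q l => simp [isFinal, plug_ne_term]
  · simp [isFinal, plug_ne_term _ (toCmd_ne_term P)]

/-- The sum of two fractions. -/
def addFrac (a b : ℕ × ℕ) : ℕ × ℕ := (a.1 * b.2 + b.1 * a.2, a.2 * b.2)

theorem fv_addFrac {a b : ℕ × ℕ} (ha : 0 < a.2) (hb : 0 < b.2) :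
    0 < (addFrac a b).2 ∧ fv (addFrac a b) = fv a + fv b := by
  have ha' : (a.2 : ℚ) ≠ 0 := by exact_mod_cast ha.ne'
  have hb' : (b.2 : ℚ) ≠ 0 := by exact_mod_cast hb.ne'
  refine ⟨Nat.mul_pos ha hb, ?_⟩
  simp only [fv, addFrac]
  push_cast
  field_simp

/-- The weight of the configurations of a list that are not terminal. -/
def liveMass (D : List ((ℕ × ℕ) × Conf)) : ℕ × ℕ :=
  D.foldr (fun s a => bif isFinal s.2 then a else addFrac s.1 a) (0, 1)

theorem liveMass_spec {D : List ((ℕ × ℕ) × Conf)} {E : List (ℚ × Cmd × Val)}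
    (h : List.Forall₂ WRepr D E) : 0 < (liveMass D).2 ∧ fv (liveMass D) = mean (surv 0) E := by
  induction h with
  | nil => simp [liveMass, fv, mean]
  | @cons s t D E hst _ ih =>
    obtain ⟨h₁, h₂, h₃⟩ := hst
    have h₄ : mean (surv 0) (t :: E) = t.1 * surv 0 t.2.1 t.2.2 + mean (surv 0) E := by
      simp [mean]
    have h₅ : liveMass (s :: D) = bif isFinal s.2 then liveMass D else addFrac s.1 (liveMass D) :=
      rfl
    rw [h₄, h₅]
    cases h : isFinal s.2
    · have hC : t.2.1 ≠ .term := fun hC => by rw [(isFinal_spec h₃).2 hC] at h; cases h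
      have := fv_addFrac h₁ ih.1
      rw [surv_zero _ hC, mul_one, ← h₂, ← ih.2]
      exact this
    · rw [(isFinal_spec h₃).1 h, surv_term, mul_zero, zero_add]
      exact ih

/-- One step of all configurations of a list. -/
def stepAll (D : List ((ℕ × ℕ) × Conf)) : List ((ℕ × ℕ) × Conf) :=
  D.flatMap fun s => (stepConf s.2).map fun t => ((s.1.1 * t.1.1, s.1.2 * t.1.2), t.2)

/-- One step of all configurations of a list. -/
noncomputable def succsAll (E : List (ℚ × Cmd × Val)) : List (ℚ × Cmd × Val) :=
  E.flatMap fun s => (succs s.2.1 s.2.2).map fun t => (s.1 * t.1, t.2)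

theorem stepAll_spec {D : List ((ℕ × ℕ) × Conf)} {E : List (ℚ × Cmd × Val)}
    (h : List.Forall₂ WRepr D E) : List.Forall₂ WRepr (stepAll D) (succsAll E) := by
  induction h with
  | nil => exact .nil
  | @cons s t D E hst _ ih =>
    obtain ⟨h₁, h₂, h₃⟩ := hst
    rw [stepAll, succsAll, List.flatMap_cons, List.flatMap_cons]
    refine List.rel_append ?_ ih
    rw [List.forall₂_map_left_iff, List.forall₂_map_right_iff]
    refine (stepConf_spec h₃).imp ?_
    rintro a b ⟨h₄, h₅, h₆⟩
    refine ⟨Nat.mul_pos h₁ h₄, ?_, h₆⟩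
    rw [← h₂, ← h₅]
    simp only [fv]
    push_cast
    rw [div_mul_div_comm]

theorem mean_En_succ (n : ℕ) (E : List (ℚ × Cmd × Val)) :
    mean (En (n + 1)) E = mean (surv 0) E + mean (En n) (succsAll E) := by
  induction E with
  | nil => simp [mean, succsAll]
  | cons t E ih =>
    have h₁ : ∀ F, mean F (t :: E) = t.1 * F t.2.1 t.2.2 + mean F E := fun F => by simp [mean]
    have h₂ : mean (En n) (succsAll (t :: E)) =
        t.1 * mean (En n) (succs t.2.1 t.2.2) + mean (En n) (succsAll E) := by
      simp [mean, succsAll, Function.comp_def, mul_assoc, List.sum_map_mul_left]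
    rw [h₁, h₁, h₂, ih]
    by_cases hC : t.2.1 = .term
    · rw [hC, En_term, surv_term]
      simp [succs, mean]
    · rw [En_succ _ _ hC, surv_zero _ hC]
      ring

/-- The weight of the configurations that are not terminal, summed up over `n` steps. -/
def totalMass (n : ℕ) (D : List ((ℕ × ℕ) × Conf)) : ℕ × ℕ :=
  ((fun s : (ℕ × ℕ) × List ((ℕ × ℕ) × Conf) => (addFrac s.1 (liveMass s.2), stepAll s.2))^[n]
    ((0, 1), D)).1

theorem totalMass_spec (n : ℕ) {D : List ((ℕ × ℕ) × Conf)} {E : List (ℚ × Cmd × Val)}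
    (h : List.Forall₂ WRepr D E) :
    0 < (totalMass n D).2 ∧ fv (totalMass n D) = mean (En n) E := by
  have key : ∀ a : ℕ × ℕ, 0 < a.2 →
      0 < ((fun s : (ℕ × ℕ) × List ((ℕ × ℕ) × Conf) =>
        (addFrac s.1 (liveMass s.2), stepAll s.2))^[n] (a, D)).1.2 ∧
      fv ((fun s : (ℕ × ℕ) × List ((ℕ × ℕ) × Conf) =>
        (addFrac s.1 (liveMass s.2), stepAll s.2))^[n] (a, D)).1 = fv a + mean (En n) E := by
    induction n generalizing D E with
    | zero =>
      intro a ha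
      refine ⟨ha, ?_⟩
      simp [mean, En_zero]
    | succ n ih =>
      intro a ha
      obtain ⟨h₁, h₂⟩ := liveMass_spec h
      obtain ⟨h₃, h₄⟩ := fv_addFrac ha h₁
      rw [Function.iterate_succ_apply]
      have := ih (stepAll_spec h) _ h₃
      rw [h₄, h₂] at this
      rw [mean_En_succ, ← add_assoc]
      exact this
  simpa [fv, totalMass] using key (0, 1) Nat.one_pos

@[fun_prop] theorem totalMass_primrec {α : Type} [Primcodable α] {f : α → ℕ}
    {g : α → List ((ℕ × ℕ) × Conf)} (hf : Primrec f) (hg : Primrec g) :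
    Primrec fun x => totalMass (f x) (g x) := by
  unfold totalMass liveMass stepAll addFrac isFinal
  fun_prop

/-! ### Membership -/

/-- The prefix sums of a list, in reverse order. -/
def prefixSums (l : List ℕ) : List ℕ := l.foldl (fun a m => (m + a.headD 0) :: a) []

theorem count_prefixSums (v : ℕ) (l : List ℕ) :
    (prefixSums l).count v = (Denumerable.raise l 0).count v := by
  have key : ∀ a : List ℕ, (l.foldl (fun a m => (m + a.headD 0) :: a) a).count v =
      a.count v + (Denumerable.raise l (a.headD 0)).count v := by
    induction l with
    | nil => simp [Denumerable.raise]
    | cons m l ih =>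
      intro a
      rw [List.foldl_cons, ih, Denumerable.raise, List.count_cons, List.count_cons]
      simp only [List.headD_cons]
      omega
  simpa [prefixSums] using key []

/-- The number of occurrences of `v` in a list. -/
def countIn (v : ℕ) (l : List ℕ) : ℕ := l.foldr (fun u k => bif Nat.beq u v then k + 1 else k) 0

theorem countIn_eq (v : ℕ) (l : List ℕ) : countIn v l = l.count v := by
  induction l with
  | nil => rfl
  | cons u l ih =>
    rw [List.count_cons, ← ih]
    have : countIn v (u :: l) = bif Nat.beq u v then countIn v l + 1 else countIn v l := rfl
    rw [this]
    by_cases h : u = v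
    · rw [show Nat.beq u v = true by simpa using h]; simp [h]
    · rw [show Nat.beq u v = false by rw [Bool.eq_false_iff]; simpa using h]; simp [h]

/-- The list of natural numbers that is encoded by the Gödel number of a valuation. -/
noncomputable def valDiffs (η : Val) : List ℕ := Denumerable.ofNat (List ℕ) (Encodable.encode η)

@[fun_prop] theorem valDiffs_primrec : Primrec valDiffs :=
  (Primrec.ofNat (List ℕ)).comp Primrec.encode

/-- A list in which every variable occurs as often as the number of its value says. -/
noncomputable def valList (η : Val) : List ℕ := prefixSums (valDiffs η)

@[fun_prop] theorem valList_primrec : Primrec valList := by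
  unfold valList prefixSums
  fun_prop

theorem countIn_valList (η : Val) (v : ℕ) : countIn v (valList η) = ratEquiv (η v) := by
  set s : Multiset ℕ := Multiset.toFinsupp.symm (Finsupp.mapRange.equiv ratEquiv ratEquiv_zero η)
    with hs
  have h₂ : Multiset.map (Denumerable.ofNat ℕ) (Denumerable.raise (valDiffs η) 0 : Multiset ℕ) = s :=
    Denumerable.ofNat_encode s
  have h₃ : (Denumerable.raise (valDiffs η) 0 : Multiset ℕ) = s := by
    rw [← h₂, Multiset.map_congr rfl fun n _ => Denumerable.ofNat_nat n, Multiset.map_id']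
  rw [countIn_eq, valList, count_prefixSums, ← Multiset.coe_count, h₃,
    ← Multiset.toFinsupp_apply, hs]
  simp

/-- The representation of a valuation. -/
noncomputable def storeOfVal (η : Val) : Store := (valList η).map fun v => (v, ratPair (countIn v (valList η)))

@[fun_prop] theorem storeOfVal_primrec : Primrec storeOfVal := by
  unfold storeOfVal countIn
  fun_prop

theorem lookup_map_graph {σ : Type} (g : ℕ → σ) (l : List ℕ) (v : ℕ) :
    (l.map fun u => (u, g u)).lookup v = if v ∈ l then some (g v) else none := by
  induction l with
  | nil => rfl
  | cons u l ih =>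
    rw [List.map_cons, List.lookup_cons, ih]
    by_cases h : v = u
    · subst h; simp
    · have : (v == u) = false := by simpa using h
      simp [this, h]

theorem storeOfVal_rep (η : Val) : (storeOfVal η).Rep η := by
  intro v
  have h : (storeOfVal η).look v = ratPair (ratEquiv (η v)) := by
    rw [Store.look, storeOfVal, lookup_map_graph, countIn_valList]
    split_ifs with hv
    · rfl
    · have h₁ := countIn_valList η v
      rw [countIn_eq, List.count_eq_zero_of_not_mem hv] at h₁
      rw [← h₁, ratPair]
      rfl
  rw [h]
  exact ⟨ratPair_pos _, (ratPair_eq _).trans (ratEquiv.symm_apply_apply (η v))⟩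

/-- The configuration in which the execution of a program begins. -/
noncomputable def initConf (x : Prog × Val) : List ((ℕ × ℕ) × Conf) :=
  [((1, 1), Encodable.encode x.1 + 1, [], storeOfVal x.2)]

theorem initConf_spec (x : Prog × Val) : List.Forall₂ WRepr (initConf x) [(1, x.1.toCmd, x.2)] :=
  .cons (.one ⟨storeOfVal_rep x.2, [], rfl, .inr ⟨x.1, rfl, rfl⟩⟩) .nil

theorem past_isSigma : IsSigma 2 PAST := by
  refine ⟨fun p => (totalMass (p.2.tail.headD 0) (initConf p.1)).1 ≤
    p.2.headD 0 * (totalMass (p.2.tail.headD 0) (initConf p.1)).2, ?_, ?_⟩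
  · have h : Primrec fun p : (Prog × Val) × List ℕ =>
        Nat.ble (totalMass (p.2.tail.headD 0) (initConf p.1)).1
          (p.2.headD 0 * (totalMass (p.2.tail.headD 0) (initConf p.1)).2) := by
      unfold initConf
      fun_prop
    refine ⟨fun _ => inferInstance, h.to_comp.of_eq fun p => ?_⟩
    rw [Bool.eq_iff_iff, Nat.ble_eq, decide_eq_true_eq]
  · rintro ⟨P, η⟩
    rw [past_iff]
    refine exists_congr fun c => forall_congr' fun n => ?_
    obtain ⟨h₁, h₂⟩ := totalMass_spec n (initConf_spec (P, η))
    have h₃ : (0 : ℚ) < (totalMass n (initConf (P, η))).2 := by exact_mod_cast h₁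
    have h₄ : En n P.toCmd η = fv (totalMass n (initConf (P, η))) := by
      rw [h₂]
      simp [mean]
    rw [h₄, fv, div_le_iff₀ h₃]
    exact_mod_cast Iff.rfl

end PGCL

/-- Positive almost-sure termination is `Σ₂⁰`-complete. -/
theorem mainTheorem3 : PGCL.IsSigmaComplete 2 PGCL.PAST :=
  ⟨PGCL.past_isSigma, PGCL.past_isSigmaHard⟩
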